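/- Let $m\ge 1$, $1\le k\le n$ and $b\ge 1$ be integers with $m\le \frac{n\log m}{k}$ (logarithms to base 2). Let $A$ be a random $m\times n$ 0-1 matrix in which each row, independently of the others, has exactly $k$ ones, in a uniformly random set of $k$ columns. There is an absolute constant $\gamma>0$ such that for every $a\in\mathbb N$, with probability at least $1-m^{-a}$ over $A$, the following holds for every real $p\ge 1$, every weight vector $c$ with $\frac1p\le c_i\le 1$ for all $i$, and every $x'\in[0,1]^n$ that maximizes $\sum_i c_ix_i$ over all $x\in[0,1]^n$ with $Ax\le b$ (coordinatewise); write $\mathrm{OPT}=\sum_i c_ix'_i$. There is $\hat x\in\{0,1\}^n$ with $$\|A\hat x\|_\infty\le b\qquad\text{and}\qquad \sum_i c_i\hat x_i\ \ge\ \gamma\cdot\frac{\mathrm{OPT}}{\max(p\log m,\ \log^2 m)^{1/b}}.$$ Moreover such an $\hat x$ can be computed in randomized polynomial time: for every $a$ there is a randomized algorithm (a probabilistic random access machine with logarithmic cost), depending only on $a$, that on every input $(A,b,c,x')$ with rational $c,x'$ halts, for all outcomes of its random bits, within time polynomial in the bit length of the input, and that for $A$, $c$, $x'$ as above with $c$,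 $x'$ rational outputs such an $\hat x$ with probability at least $1-m^{-a}$ over its random bits. -/

import Mathlib

open scoped Matrix NNRat

namespace PackingRounding

/-! ### Uniform probability on a finite set -/

open Classical in
/-- The probability of the event `E` under the uniform distribution on a finite type. -/
noncomputable def uniformProb {Ω : Type} [Fintype Ω] (E : Ω → Prop) : ℝ :=
  ((Finset.univ.filter E).card : ℝ) / (Fintype.card Ω : ℝ)

/-! ### Random matrices with `k` ones per row -/

/-- The sample space of the random `m × n` matrices with exactly `k` ones per row: each row chooses
the set of its `k` columns. The uniform distribution on this finite product is the distribution
under which the rows are independent and each is uniform among the `k`-subsets of the columns. -/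
abbrev RowChoice (m n k : ℕ) : Type := Fin m → {s : Finset (Fin n) // s.card = k}

/-- The row supports of a matrix in the family. -/
def RowChoice.supports {m n k : ℕ} (R : RowChoice m n k) : Fin m → Finset (Fin n) :=
  fun j => (R j).1

/-- The 0-1 matrix whose `j`-th row is the indicator vector of `S j`. -/
def zeroOneMatrix {m n : ℕ} (S : Fin m → Finset (Fin n)) : Matrix (Fin m) (Fin n) ℝ :=
  Matrix.of fun j i => if i ∈ S j then 1 else 0

/-! ### The packing program and its roundings -/

/-- The polytope `{z ∈ [0,1]ⁿ : A z ≤ b}`. -/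
def packingPolytope {m n : ℕ} (A : Matrix (Fin m) (Fin n) ℝ) (b : ℕ) : Set (Fin n → ℝ) :=
  {z | (∀ i, 0 ≤ z i ∧ z i ≤ 1) ∧ ∀ j, (A *ᵥ z) j ≤ (b : ℝ)}

/-- `x` is an optimal solution of the linear program: maximize `c ⬝ᵥ z` over the polytope. -/
def IsLPOptimal {m n : ℕ} (A : Matrix (Fin m) (Fin n) ℝ) (b : ℕ) (c x : Fin n → ℝ) : Prop :=
  x ∈ packingPolytope A b ∧ IsMaxOn (fun z => c ⬝ᵥ z) (packingPolytope A b) x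

/-- The factor `max (p log m, log² m) ^ (1/b)`, with logarithms to base 2. -/
noncomputable def approxFactor (m b : ℕ) (p : ℝ) : ℝ :=
  (max (p * Real.logb 2 m) (Real.logb 2 m ^ 2)) ^ (1 / (b : ℝ))

/-- `y` is a 0-1 vector with `‖A y‖_∞ ≤ b` (the norm of `Fin m → ℝ` is the maximum norm) and
objective value at least `γ · OPT / max (p log m, log² m) ^ (1/b)`, where `OPT = c ⬝ᵥ x`. -/
def IsGoodRounding {m n : ℕ} (γ : ℝ) (A : Matrix (Fin m) (Fin n) ℝ) (b : ℕ) (p : ℝ)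
    (c x y : Fin n → ℝ) : Prop :=
  (∀ i, y i = 0 ∨ y i = 1) ∧ ‖A *ᵥ y‖ ≤ (b : ℝ) ∧
    γ * (c ⬝ᵥ x / approxFactor m b p) ≤ c ⬝ᵥ y

/-! ### Probabilistic random access machines with logarithmic cost

A program works on finitely many arrays (array number `a`, index `i`) whose cells hold natural
numbers. Every elementary operation costs one plus the bit length of the number it produces, so that
the cost of a run is polynomially related to the running time of a Turing machine. -/

/-- Expressions. Subtraction is truncated and division rounds down (with `x / 0 = 0`). -/
inductive Expr : Type
  | lit (v : ℕ)
  | get (a : ℕ) (i : Expr)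
  | add (e f : Expr)
  | sub (e f : Expr)
  | mul (e f : Expr)
  | div (e f : Expr)

/-- The value of an expression when the arrays have the contents `σ`. -/
def Expr.eval (σ : ℕ → ℕ → ℕ) : Expr → ℕ
  | .lit v => v
  | .get a i => σ a (i.eval σ)
  | .add e f => e.eval σ + f.eval σ
  | .sub e f => e.eval σ - f.eval σ
  | .mul e f => e.eval σ * f.eval σ
  | .div e f => e.eval σ / f.eval σ

/-- The cost of evaluating an expression: one plus the bit length of the value, summed over all
subexpressions. -/
def Expr.cost (σ : ℕ → ℕ → ℕ) : Expr → ℕ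
  | .lit v => 1 + v.size
  | .get a i => i.cost σ + (1 + (σ a (i.eval σ)).size)
  | .add e f => e.cost σ + f.cost σ + (1 + (e.eval σ + f.eval σ).size)
  | .sub e f => e.cost σ + f.cost σ + (1 + (e.eval σ - f.eval σ).size)
  | .mul e f => e.cost σ + f.cost σ + (1 + (e.eval σ * f.eval σ).size)
  | .div e f => e.cost σ + f.cost σ + (1 + (e.eval σ / f.eval σ).size)

/-- Programs. `set a i e` writes the value of `e` into cell `i` of array `a`, `flip a i` writes a
random bit there; in `cond` and `loop` an expression counts as true if its value is not zero. -/
inductive Prog : Type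
  | skip
  | set (a : ℕ) (i e : Expr)
  | flip (a : ℕ) (i : Expr)
  | seq (P Q : Prog)
  | cond (e : Expr) (P Q : Prog)
  | loop (e : Expr) (P : Prog)

/-- A machine state: the contents of the arrays and the number of random bits used so far. -/
structure State : Type where
  arr : ℕ → ℕ → ℕ
  used : ℕ

/-- The array contents after writing `v` into cell `i` of array `a`. -/
def write (σ : ℕ → ℕ → ℕ) (a i v : ℕ) : ℕ → ℕ → ℕ :=
  Function.update σ a (Function.update (σ a) i v)

/-- `Exec ω P s s' t`: with the sequence `ω` of random bits, the program `P` started in the state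
`s` halts in the state `s'` at the cost `t`. -/
inductive Exec (ω : ℕ → Bool) : Prog → State → State → ℕ → Prop
  | skip (s : State) : Exec ω .skip s s 1
  | set (s : State) (a : ℕ) (i e : Expr) :
      Exec ω (.set a i e) s ⟨write s.arr a (i.eval s.arr) (e.eval s.arr), s.used⟩
        (i.cost s.arr + e.cost s.arr + 1)
  | flip (s : State) (a : ℕ) (i : Expr) :
      Exec ω (.flip a i) s ⟨write s.arr a (i.eval s.arr) (ω s.used).toNat, s.used + 1⟩
        (i.cost s.arr + 1)
  | seq {P Q : Prog} {s s' s'' : State} {t t' : ℕ} (h : Exec ω P s s' t)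
      (h' : Exec ω Q s' s'' t') : Exec ω (.seq P Q) s s'' (t + t')
  | condTrue {e : Expr} {P Q : Prog} {s s' : State} {t : ℕ} (he : e.eval s.arr ≠ 0)
      (h : Exec ω P s s' t) : Exec ω (.cond e P Q) s s' (e.cost s.arr + 1 + t)
  | condFalse {e : Expr} {P Q : Prog} {s s' : State} {t : ℕ} (he : e.eval s.arr = 0)
      (h : Exec ω Q s s' t) : Exec ω (.cond e P Q) s s' (e.cost s.arr + 1 + t)
  | loopTrue {e : Expr} {P : Prog} {s s' s'' : State} {t t' : ℕ} (he : e.eval s.arr ≠ 0)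
      (h : Exec ω P s s' t) (h' : Exec ω (.loop e P) s' s'' t') :
      Exec ω (.loop e P) s s'' (e.cost s.arr + 1 + t + t')
  | loopFalse {e : Expr} {P : Prog} {s : State} (he : e.eval s.arr = 0) :
      Exec ω (.loop e P) s s (e.cost s.arr + 1)

/-- `T` random bits, continued by zeros. A run of cost at most `T` reads at most `T` bits. -/
def coins {T : ℕ} (r : Fin T → Bool) : ℕ → Bool :=
  fun i => if h : i < T then r ⟨i, h⟩ else false

/-! ### Inputs and outputs of a rounding algorithm -/

/-- An input with rational data: the row supports of a 0-1 matrix, the right-hand side, the weights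
and the fractional solution. -/
structure Input (m n : ℕ) : Type where
  supp : Fin m → Finset (Fin n)
  b : ℕ
  c : Fin n → ℚ≥0
  x : Fin n → ℚ≥0

/-- The length of an input: the number of matrix entries, rows and columns plus the bit lengths of
the numbers. -/
def Input.length {m n : ℕ} (I : Input m n) : ℕ :=
  m * n + m + n + I.b.size +
    ∑ i, ((I.c i).num.size + (I.c i).den.size + (I.x i).num.size + (I.x i).den.size)

/-- A finite list of numbers as the contents of an array. -/
def ofFin {n : ℕ} (v : Fin n → ℕ) : ℕ → ℕ :=
  fun i => if h : i < n then v ⟨i, h⟩ else 0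

/-- The initial contents of the arrays: array 0 holds `m, n, b`, array 1 the matrix (the entry in
row `j` and column `i` in cell `n * j + i`), arrays 2 and 3 the numerators and denominators of the
weights, arrays 4 and 5 those of the fractional solution; all other cells are zero. -/
def Input.load {m n : ℕ} (I : Input m n) : ℕ → ℕ → ℕ
  | 0 => ofFin ![m, n, I.b]
  | 1 => ofFin fun t : Fin (m * n) =>
      if (finProdFinEquiv.symm t).2 ∈ I.supp (finProdFinEquiv.symm t).1 then 1 else 0
  | 2 => ofFin fun i => (I.c i).num
  | 3 => ofFin fun i => (I.c i).den
  | 4 => ofFin fun i => (I.x i).num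
  | 5 => ofFin fun i => (I.x i).den
  | _ => fun _ => 0

/-- The output vector, read from array 6. -/
def State.output (s : State) (n : ℕ) : Fin n → ℝ :=
  fun i => (s.arr 6 i : ℝ)

/-- With the random bits `ω`, the program `P` halts on the input `I` at cost at most `T`, in a state
whose output vector satisfies `G`. -/
def RunsTo {m n : ℕ} (P : Prog) (I : Input m n) (T : ℕ) (ω : ℕ → Bool)
    (G : (Fin n → ℝ) → Prop) : Prop :=
  ∃ (s : State) (t : ℕ), Exec ω P ⟨I.load, 0⟩ s t ∧ t ≤ T ∧ G (s.output n)

/-- On every input and for all outcomes of the random bits, the program `P` halts at cost at most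
`q` of the length of the input. -/
def RunsInTime (P : Prog) (q : Polynomial ℕ) : Prop :=
  ∀ (m n : ℕ) (I : Input m n) (ω : ℕ → Bool), RunsTo P I (q.eval I.length) ω fun _ => True

end PackingRounding

/-! The rounding exists for every matrix of the family, not merely for most of them, and a
deterministic program finds it. The hypothesis on `m` excludes `m = 1`, where the logarithm
vanishes. For `m ≥ 2` both probabilities equal 1.

Fix `β ≥ 1` and round each coordinate independently to 1 with probability `x i / β`. For
probabilities `u`, `rowFactor` is the expectation of `β ^ s`, where `s` counts the chosen earlier
columns of a row. By Markov's inequality, `penalty / β ^ b` therefore bounds the expected weight,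
summed over the rows, of chosen columns that meet a row already holding `b` chosen ones. So
`potential` is a pessimistic estimator for the value that survives after such columns are dropped.
It is affine in each coordinate, and the method of conditional expectations rounds the coordinates
one by one without decreasing it (`potential_le_roundReal`). No column has to be dropped afterwards:
raising a coordinate to 1 in a row that already holds `b` ones costs at least its whole weight, so
the strict comparison in the rule rejects it (`exists_rowSum_roundReal`).

At the start every row factor is at most `e ^ b ≤ 3 ^ b`. If the row sums of `c i * x i` add up to
at most `lam * OPT` and `2 * lam * 3 ^ b ≤ β ^ b`, the potential is at least `OPT / (2 * β)`
(`le_potential_div`). By `IsLPOptimal.sum_le`, `lam = min m (p * log m)` will do: besides the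
trivial bound `m`, optimality allows a comparison with a constant feasible vector. Hence some
integer `β` of order `lam ^ (1 / b)` suffices (`exists_base`).

The number `p` is not part of the input, so the program tries all `β` from 1 to `6 * m + 1` and
keeps the best candidate; all candidates are feasible. Capping `b` at `m + n` keeps the exponents
polynomial. With `Q` the common denominator of `x` and `N = β * Q`, multiplying the penalties by `N
^ n` makes all comparisons exact in natural numbers (`roundNat_cast`). A weakest-precondition
calculus that also tracks bit lengths verifies the program and its running time
(`Input.wp_mainProg`). -/

namespace PackingRounding

/-! ### A weakest-precondition calculus with cost bounds -/

/-- If all cells have bit length at most `B`, then the value of the expression has bit length at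
most `e.sizeWeight * (B + 1)`. -/
def Expr.sizeWeight : Expr → ℕ
  | .lit v => v.size
  | .get _ _ => 1
  | .add e f => e.sizeWeight + f.sizeWeight
  | .sub e _ => e.sizeWeight
  | .mul e f => e.sizeWeight + f.sizeWeight
  | .div e _ => e.sizeWeight

/-- If all cells have bit length at most `B`, then the expression is evaluated at cost at most
`e.costWeight * (B + 1)`. -/
def Expr.costWeight : Expr → ℕ
  | .lit v => 1 + v.size
  | .get _ i => i.costWeight + 1
  | .add e f => e.costWeight + f.costWeight + (1 + (e.sizeWeight + f.sizeWeight))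
  | .sub e f => e.costWeight + f.costWeight + (1 + e.sizeWeight)
  | .mul e f => e.costWeight + f.costWeight + (1 + (e.sizeWeight + f.sizeWeight))
  | .div e f => e.costWeight + f.costWeight + (1 + e.sizeWeight)

/-- All cells have bit length at most `B`. -/
def SizeLE (B : ℕ) (σ : ℕ → ℕ → ℕ) : Prop := ∀ a i, (σ a i).size ≤ B

/-- For nonzero summands both powers of two are at least 2, and `s + t ≤ s * t` for such numbers; a
zero summand is split off first. -/
theorem size_add_le (x y : ℕ) : (x + y).size ≤ x.size + y.size := by
  rcases Nat.eq_zero_or_pos x with rfl | hx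
  · simp
  rcases Nat.eq_zero_or_pos y with rfl | hy
  · simp
  have hx' := Nat.size_pos.2 hx
  have hy' := Nat.size_pos.2 hy
  have h1 := Nat.lt_size_self x
  have h2 := Nat.lt_size_self y
  rw [Nat.size_le, pow_add]
  have h3 : 2 ^ 1 ≤ 2 ^ x.size := Nat.pow_le_pow_right (by norm_num) hx'
  have h4 : 2 ^ 1 ≤ 2 ^ y.size := Nat.pow_le_pow_right (by norm_num) hy'
  nlinarith

theorem size_mul_le (x y : ℕ) : (x * y).size ≤ x.size + y.size := by
  rw [Nat.size_le, pow_add]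
  exact Nat.mul_lt_mul'' (Nat.lt_size_self x) (Nat.lt_size_self y)

theorem Expr.size_eval_le {B : ℕ} {σ : ℕ → ℕ → ℕ} (hσ : SizeLE B σ) (e : Expr) :
    (e.eval σ).size ≤ e.sizeWeight * (B + 1) := by
  induction e with
  | lit v => exact Nat.le_mul_of_pos_right _ (Nat.succ_pos B)
  | get a i _ =>
    have := hσ a (i.eval σ)
    simp only [Expr.eval, Expr.sizeWeight]
    omega
  | add e f he hf =>
    simp only [Expr.eval, Expr.sizeWeight, add_mul]
    exact (size_add_le _ _).trans (Nat.add_le_add he hf)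
  | sub e f he hf => exact (Nat.size_le_size (Nat.sub_le _ _)).trans he
  | mul e f he hf =>
    simp only [Expr.eval, Expr.sizeWeight, add_mul]
    exact (size_mul_le _ _).trans (Nat.add_le_add he hf)
  | div e f he hf => exact (Nat.size_le_size (Nat.div_le_self _ _)).trans he

theorem Expr.cost_le {B : ℕ} {σ : ℕ → ℕ → ℕ} (hσ : SizeLE B σ) (e : Expr) :
    e.cost σ ≤ e.costWeight * (B + 1) := by
  induction e with
  | lit v => exact Nat.le_mul_of_pos_right _ (Nat.succ_pos B)
  | get a i hi =>
    have := hσ a (i.eval σ)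
    simp only [Expr.cost, Expr.costWeight]
    rw [add_mul]
    omega
  | add e f he hf =>
    have := Expr.size_eval_le hσ (.add e f)
    simp only [Expr.cost, Expr.costWeight, Expr.eval, Expr.sizeWeight] at this ⊢
    nlinarith
  | sub e f he hf =>
    have := Expr.size_eval_le hσ (.sub e f)
    simp only [Expr.cost, Expr.costWeight, Expr.eval, Expr.sizeWeight] at this ⊢
    nlinarith
  | mul e f he hf =>
    have := Expr.size_eval_le hσ (.mul e f)
    simp only [Expr.cost, Expr.costWeight, Expr.eval, Expr.sizeWeight] at this ⊢
    nlinarith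
  | div e f he hf =>
    have := Expr.size_eval_le hσ (.div e f)
    simp only [Expr.cost, Expr.costWeight, Expr.eval, Expr.sizeWeight] at this ⊢
    nlinarith

/-- A bound for the cost of a run in which all cells have bit length at most `B` and every loop is
iterated at most `ℓ` times. -/
def Prog.costBound {R : Type} [CommSemiring R] (B ℓ : R) : Prog → R
  | .skip => 1
  | .set _ i e => (i.costWeight + e.costWeight : ℕ) * (B + 1) + 1
  | .flip _ i => (i.costWeight : ℕ) * (B + 1) + 1
  | .seq P Q => P.costBound B ℓ + Q.costBound B ℓ
  | .cond e P Q => (e.costWeight : ℕ) * (B + 1) + 1 + (P.costBound B ℓ + Q.costBound B ℓ)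
  | .loop e P => (ℓ + 1) * ((e.costWeight : ℕ) * (B + 1) + 1 + P.costBound B ℓ)

/-- The reason for defining the cost bound over any commutative semiring: over `ℕ` it bounds runs,
over polynomials it gives the time bound, and evaluation links the two. -/
theorem Prog.eval_costBound (B ℓ : Polynomial ℕ) (L : ℕ) (P : Prog) :
    (P.costBound B ℓ).eval L = P.costBound (B.eval L) (ℓ.eval L) := by
  induction P <;> simp_all [Prog.costBound]

/-- Started with the array contents `σ`, the program halts, whatever the random bits, at cost at
most `P.costBound B ℓ`, with array contents of bit length at most `B` that satisfy `post`. -/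
def WP (B ℓ : ℕ) (P : Prog) (post : (ℕ → ℕ → ℕ) → Prop) (σ : ℕ → ℕ → ℕ) : Prop :=
  ∃ τ, SizeLE B τ ∧ post τ ∧
    ∀ ω k, ∃ t, t ≤ P.costBound B ℓ ∧ Exec ω P ⟨σ, k⟩ ⟨τ, k⟩ t

variable {B ℓ : ℕ} {σ : ℕ → ℕ → ℕ} {post : (ℕ → ℕ → ℕ) → Prop}

theorem write_apply (σ : ℕ → ℕ → ℕ) (a i v a' : ℕ) :
    write σ a i v a' = if a' = a then Function.update (σ a) i v else σ a' := by
  unfold write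
  rw [Function.update_apply]

theorem SizeLE.write (hσ : SizeLE B σ) {a i v : ℕ} (hv : v.size ≤ B) :
    SizeLE B (write σ a i v) := by
  intro a' i'
  rw [write_apply]
  split_ifs
  · rw [Function.update_apply]
    split_ifs
    · exact hv
    · exact hσ _ _
  · exact hσ _ _

theorem WP.skip (hσ : SizeLE B σ) (h : post σ) : WP B ℓ .skip post σ :=
  ⟨σ, hσ, h, fun _ _ => ⟨1, le_rfl, .skip _⟩⟩

theorem WP.set (hσ : SizeLE B σ) {a : ℕ} {i e : Expr} (hv : (e.eval σ).size ≤ B)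
    (h : post (PackingRounding.write σ a (i.eval σ) (e.eval σ))) :
    WP B ℓ (.set a i e) post σ := by
  refine ⟨_, hσ.write hv, h, fun ω k => ⟨_, ?_, .set _ _ _ _⟩⟩
  have h1 := i.cost_le hσ
  have h2 := e.cost_le hσ
  simp only [Prog.costBound, Nat.cast_id, add_mul _ _ (B + 1)]
  omega

theorem WP.seq {P Q : Prog} (h : WP B ℓ P (fun τ => SizeLE B τ → WP B ℓ Q post τ) σ) :
    WP B ℓ (.seq P Q) post σ := by
  obtain ⟨τ, hτ, h, hP⟩ := h
  obtain ⟨υ, hυ, h, hQ⟩ := h hτ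
  refine ⟨υ, hυ, h, fun ω k => ?_⟩
  obtain ⟨t, ht, hP⟩ := hP ω k
  obtain ⟨t', ht', hQ⟩ := hQ ω k
  exact ⟨t + t', Nat.add_le_add ht ht', .seq hP hQ⟩

theorem WP.cond (hσ : SizeLE B σ) {e : Expr} {P Q : Prog} (hP : e.eval σ ≠ 0 → WP B ℓ P post σ)
    (hQ : e.eval σ = 0 → WP B ℓ Q post σ) : WP B ℓ (.cond e P Q) post σ := by
  have he := e.cost_le hσ
  by_cases h : e.eval σ = 0
  · obtain ⟨τ, hτ, hpost, hQ⟩ := hQ h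
    refine ⟨τ, hτ, hpost, fun ω k => ?_⟩
    obtain ⟨t, ht, hQ⟩ := hQ ω k
    refine ⟨_, ?_, .condFalse h hQ⟩
    simp only [Prog.costBound, Nat.cast_id]
    omega
  · obtain ⟨τ, hτ, hpost, hP⟩ := hP h
    refine ⟨τ, hτ, hpost, fun ω k => ?_⟩
    obtain ⟨t, ht, hP⟩ := hP ω k
    refine ⟨_, ?_, .condTrue h hP⟩
    simp only [Prog.costBound, Nat.cast_id]
    omega

theorem WP.mono {P : Prog} {post' : (ℕ → ℕ → ℕ) → Prop} (h : WP B ℓ P post σ)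
    (hpost : ∀ τ, post τ → post' τ) : WP B ℓ P post' σ := by
  obtain ⟨τ, hτ, h, hP⟩ := h
  exact ⟨τ, hτ, hpost τ h, hP⟩

/-- The scalar variable stored in cell `0` of array `a`. -/
abbrev Expr.var (a : ℕ) : Expr := .get a (.lit 0)

/-- Assignment to a scalar variable. -/
abbrev Prog.assign (a : ℕ) (e : Expr) : Prog := .set a (.lit 0) e

/-- `for i in 0, ..., e - 1 do P`, with the loop variable in array `i`. -/
def Prog.forLoop (i : ℕ) (e : Expr) (P : Prog) : Prog :=
  .seq (.assign i (.lit 0))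
    (.loop (.sub e (.var i)) (.seq P (.assign i (.add (.var i) (.lit 1)))))

/-- The usual invariant rule. The invariant is required after the counter has been written, so it
may speak about the counter's array. The counter never exceeds `k`, whence `hkB` suffices for its
bit length. -/
theorem WP.forLoop {i : ℕ} {e : Expr} {P : Prog} (Inv : ℕ → (ℕ → ℕ → ℕ) → Prop) (k : ℕ)
    (hσ : SizeLE B σ) (hk : k ≤ ℓ) (hkB : k.size ≤ B)
    (h0 : Inv 0 (PackingRounding.write σ i 0 0))
    (he : ∀ j τ, Inv j τ → e.eval τ = k)
    (hstep : ∀ j τ, j < k → SizeLE B τ → Inv j τ → τ i 0 = j →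
      WP B ℓ P (fun υ => υ i 0 = j ∧ Inv (j + 1) (PackingRounding.write υ i 0 (j + 1))) τ)
    (hpost : ∀ τ, Inv k τ → post τ) :
    WP B ℓ (.forLoop i e P) post σ := by
  refine WP.seq (WP.set hσ (by simp [Expr.eval]) fun hσ' => ?_)
  simp only [Expr.eval] at hσ' ⊢
  set body : Prog := .seq P (.assign i (.add (.var i) (.lit 1))) with hbody
  set test : Expr := .sub e (.var i) with htest
  have step : ∀ j τ, j < k → SizeLE B τ → Inv j τ → τ i 0 = j →
      WP B ℓ body (fun υ => υ i 0 = j + 1 ∧ Inv (j + 1) υ) τ := by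
    intro j τ hj hτ hI hi
    refine WP.seq ((hstep j τ hj hτ hI hi).mono fun υ hυ hυB => ?_)
    have hval : (Expr.add (.var i) (.lit 1)).eval υ = j + 1 := by simp [Expr.eval, hυ.1]
    refine WP.set hυB ?_ ?_
    · rw [hval]
      exact (Nat.size_le_size hj).trans hkB
    · rw [hval]
      exact ⟨by simp [write_apply, Expr.eval], hυ.2⟩
  -- Induction on the number `d` of remaining rounds; the final failing test accounts for `d + 1`.
  have main : ∀ d j τ, j + d = k → SizeLE B τ → Inv j τ → τ i 0 = j →
      ∃ υ, SizeLE B υ ∧ Inv k υ ∧ ∀ ω u, ∃ t,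
        t ≤ (d + 1) * (test.costWeight * (B + 1) + 1 + body.costBound B ℓ) ∧
          Exec ω (.loop test body) ⟨τ, u⟩ ⟨υ, u⟩ t := by
    intro d
    induction d with
    | zero =>
      intro j τ hj hτ hI hi
      obtain rfl : j = k := hj
      refine ⟨τ, hτ, hI, fun ω u => ⟨_, ?_, .loopFalse ?_⟩⟩
      · have := test.cost_le hτ
        simp only
        omega
      · simp [htest, Expr.eval, he _ _ hI, hi]
    | succ d ih =>
      intro j τ hj hτ hI hi
      obtain ⟨υ, hυ, ⟨hi', hI'⟩, hrun⟩ := step j τ (by omega) hτ hI hi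
      obtain ⟨ρ, hρ, hIk, hrun'⟩ := ih (j + 1) υ (by omega) hυ hI' hi'
      refine ⟨ρ, hρ, hIk, fun ω u => ?_⟩
      obtain ⟨t, ht, hrun⟩ := hrun ω u
      obtain ⟨t', ht', hrun'⟩ := hrun' ω u
      refine ⟨_, ?_, .loopTrue ?_ hrun hrun'⟩
      · have := test.cost_le hτ
        rw [add_mul (d + 1)]
        simp only
        omega
      · simp only [htest, Expr.eval, he _ _ hI, hi]
        omega
  obtain ⟨υ, hυ, hI, hrun⟩ := main k 0 _ (by omega) hσ' h0 (by simp [write_apply])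
  refine ⟨υ, hυ, hpost υ hI, fun ω u => ?_⟩
  obtain ⟨t, ht, hrun⟩ := hrun ω u
  refine ⟨t, ht.trans ?_, hrun⟩
  simp only [Prog.costBound, Nat.cast_id]
  gcongr

end PackingRounding

namespace PackingRounding

/-! ### The rounding procedure in integer arithmetic -/

/-- `∏ l < j, (N + w l * ((β - 1) * U l))`. -/
def prefixProd (N β : ℕ) (w U : ℕ → ℕ) : ℕ → ℕ
  | 0 => 1
  | j + 1 => prefixProd N β w U j * (N + w j * ((β - 1) * U j))

/-- The penalty of a row with indicator vector `w`, scaled by a power of `N`. -/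
def rowLoss (N β : ℕ) (w C U : ℕ → ℕ) : ℕ → ℕ
  | 0 => 0
  | j + 1 => rowLoss N β w C U j * N + w j * (C j * U j * prefixProd N β w U j)

/-- The sum of the penalties of all rows. -/
def totalLoss (m n N β : ℕ) (A C U : ℕ → ℕ) : ℕ :=
  ∑ r ∈ Finset.range m, rowLoss N β (fun j => A (n * r + j)) C U n

/-- Round the first coordinates of `U` to `0` or `N`, one after the other, by comparing the
penalties with the gain. -/
def roundNat (m n N β K : ℕ) (A C U : ℕ → ℕ) : ℕ → ℕ → ℕ
  | 0 => U
  | i + 1 =>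
    let V := roundNat m n N β K A C U i
    if totalLoss m n N β A C (Function.update V i N) <
        K * C i + totalLoss m n N β A C (Function.update V i 0)
    then Function.update V i N else Function.update V i 0

section Bounds

variable {m n N β G L : ℕ} {A w C U : ℕ → ℕ}

/-- Each factor is at most `G + (G - 1) * G = G * G`; this is where the `- 1` in `β - 1` is used. -/
theorem prefixProd_le (hN : N ≤ G) (hβ : β ≤ G) (hG : 1 ≤ G) (hw : ∀ j, w j ≤ 1)
    (hU : ∀ j, U j ≤ G) (j : ℕ) : prefixProd N β w U j ≤ (G * G) ^ j := by
  induction j with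
  | zero => simp [prefixProd]
  | succ j ih =>
    rw [prefixProd, pow_succ]
    refine Nat.mul_le_mul ih ?_
    have h1 : w j * ((β - 1) * U j) ≤ 1 * ((G - 1) * G) :=
      Nat.mul_le_mul (hw j) (Nat.mul_le_mul (Nat.sub_le_sub_right hβ 1) (hU j))
    obtain ⟨g, rfl⟩ : ∃ g, G = g + 1 := ⟨G - 1, by omega⟩
    simp only [Nat.add_sub_cancel] at h1
    nlinarith

theorem rowLoss_le (hN : N ≤ G) (hβ : β ≤ G) (hG : 1 ≤ G) (hw : ∀ j, w j ≤ 1)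
    (hC : ∀ j, C j ≤ G) (hU : ∀ j, U j ≤ G) (j : ℕ) :
    rowLoss N β w C U j ≤ j * (G * G * (G * G) ^ j) := by
  induction j with
  | zero => simp [rowLoss]
  | succ j ih =>
    rw [rowLoss]
    have h1 : rowLoss N β w C U j * N ≤ j * (G * G * (G * G) ^ j) * (G * G) :=
      Nat.mul_le_mul ih (hN.trans (Nat.le_mul_of_pos_left _ hG))
    have h2 : w j * (C j * U j * prefixProd N β w U j) ≤ 1 * (G * G * (G * G) ^ j) :=
      Nat.mul_le_mul (hw j) (Nat.mul_le_mul (Nat.mul_le_mul (hC j) (hU j))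
        (prefixProd_le hN hβ hG hw hU j))
    have h3 : G * G * (G * G) ^ j ≤ G * G * (G * G) ^ j * (G * G) :=
      Nat.le_mul_of_pos_right _ (Nat.mul_pos hG hG)
    calc _ ≤ j * (G * G * (G * G) ^ j) * (G * G) + 1 * (G * G * (G * G) ^ j) := Nat.add_le_add h1 h2
      _ ≤ j * (G * G * (G * G) ^ j) * (G * G) + G * G * (G * G) ^ j * (G * G) := by omega
      _ = _ := by ring

theorem rowLoss_le_pow (hN : N ≤ G) (hβ : β ≤ G) (hG : 1 ≤ G) (hw : ∀ j, w j ≤ 1)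
    (hC : ∀ j, C j ≤ G) (hU : ∀ j, U j ≤ G) (hL : L ≤ G) {j : ℕ} (hj : j ≤ L) :
    rowLoss N β w C U j ≤ G ^ (2 * L + 3) := by
  calc rowLoss N β w C U j ≤ j * (G * G * (G * G) ^ j) := rowLoss_le hN hβ hG hw hC hU j
    _ ≤ G * (G * G * (G * G) ^ L) :=
      Nat.mul_le_mul (hj.trans hL) (Nat.mul_le_mul le_rfl
        (Nat.pow_le_pow_right (Nat.mul_pos hG hG) hj))
    _ = G ^ (2 * L + 3) := by rw [mul_pow]; ring

theorem sum_rowLoss_le_pow (hN : N ≤ G) (hβ : β ≤ G) (hG : 1 ≤ G) (hA : ∀ j, A j ≤ 1)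
    (hC : ∀ j, C j ≤ G) (hU : ∀ j, U j ≤ G) (hL : L ≤ G) {r : ℕ} (hr : r ≤ L) (hn : n ≤ L) :
    ∑ r ∈ Finset.range r, rowLoss N β (fun j => A (n * r + j)) C U n ≤ G ^ (2 * L + 4) := by
  calc _ ≤ ∑ _r ∈ Finset.range r, G ^ (2 * L + 3) := Finset.sum_le_sum fun r _ =>
        rowLoss_le_pow hN hβ hG (fun j => hA _) hC hU hL hn
    _ = r * G ^ (2 * L + 3) := by simp
    _ ≤ G * G ^ (2 * L + 3) := Nat.mul_le_mul_right _ (hr.trans hL)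
    _ = G ^ (2 * L + 4) := by ring

end Bounds

/-! ### The program

Arrays `8`-`12` hold the common denominators of the weights and of the fractional solution, `β`, `N`
and `K`; `13`-`15` the running product, row penalty and total penalty; `16` a saved penalty; `17` and
`18` the current and the best value; `20`-`22` and `25` loop variables; `7` the vector that is being
rounded; `23` and `24` the weights and the fractional solution, scaled to integers. -/

open PackingRounding.Expr PackingRounding.Prog

/-- Computes `totalLoss` into array `15`. -/
def lossProg : Prog :=
  seq (assign 15 (lit 0)) <|
  forLoop 22 (get 0 (lit 0)) <|
    seq (assign 13 (lit 1)) <| seq (assign 14 (lit 0)) <| seq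
      (forLoop 21 (get 0 (lit 1)) <| seq
        (assign 14 (add (mul (var 14) (var 11))
          (mul (get 1 (add (mul (get 0 (lit 1)) (var 22)) (var 21)))
            (mul (mul (get 23 (var 21)) (get 7 (var 21))) (var 13)))))
        (assign 13 (mul (var 13) (add (var 11)
          (mul (get 1 (add (mul (get 0 (lit 1)) (var 22)) (var 21)))
            (mul (sub (var 10) (lit 1)) (get 7 (var 21))))))))
      (assign 15 (add (var 15) (var 14)))

/-- `τ` agrees with `σ` except possibly on the arrays of the list `l`. -/
def SameOff (l : List ℕ) (σ τ : ℕ → ℕ → ℕ) : Prop := ∀ a, a ∉ l → τ a = σ a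

theorem SameOff.refl (l : List ℕ) (σ : ℕ → ℕ → ℕ) : SameOff l σ σ := fun _ _ => rfl

theorem SameOff.trans {l l' : List ℕ} {σ τ υ : ℕ → ℕ → ℕ} (h : SameOff l σ τ)
    (h' : SameOff l' τ υ) (hl : l' ⊆ l) : SameOff l σ υ :=
  fun a ha => (h' a fun h => ha (hl h)).trans (h a ha)

theorem SameOff.write {l : List ℕ} {σ τ : ℕ → ℕ → ℕ} (h : SameOff l σ τ) {a : ℕ} (ha : a ∈ l)
    (i v : ℕ) : SameOff l σ (write τ a i v) := by
  intro a' ha'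
  rw [write_apply, if_neg (by rintro rfl; exact ha' ha)]
  exact h a' ha'

/-- The bounds under which `lossProg` runs. -/
structure LossBounds (B ℓ G L : ℕ) (σ : ℕ → ℕ → ℕ) : Prop where
  rows : σ 0 0 ≤ L
  cols : σ 0 1 ≤ L
  matrix : ∀ t, σ 1 t ≤ 1
  vec : ∀ j, σ 7 j ≤ G
  weights : ∀ j, σ 23 j ≤ G
  base : σ 10 0 ≤ G
  scale : σ 11 0 ≤ G
  one_le : 1 ≤ G
  len_le : L ≤ G
  iter : L ≤ ℓ
  pow_lt : G ^ (3 * L + 4) < 2 ^ B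

variable {B ℓ G L : ℕ} {σ : ℕ → ℕ → ℕ}

/-- Every number that is stored after the scaling phase is at most a power of `G` with exponent at
most `3 * L + 4`: the total penalty needs `2 * L + 4`, and the threshold `K` needs `3 * L`. -/
theorem size_le_of_le_pow (hG : 1 ≤ G) (h : G ^ (3 * L + 4) < 2 ^ B) {v e : ℕ} (hv : v ≤ G ^ e)
    (he : e ≤ 3 * L + 4) : v.size ≤ B :=
  Nat.size_le.2 ((hv.trans (Nat.pow_le_pow_right hG he)).trans_lt h)

theorem LossBounds.size_le (h : LossBounds B ℓ G L σ) {v e : ℕ} (hv : v ≤ G ^ e)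
    (he : e ≤ 3 * L + 4) : v.size ≤ B :=
  size_le_of_le_pow h.one_le h.pow_lt hv he

theorem wp_lossProg (hσ : SizeLE B σ) (h : LossBounds B ℓ G L σ) :
    WP B ℓ lossProg (fun τ => SameOff [13, 14, 15, 21, 22] σ τ ∧
      τ 15 0 = totalLoss (σ 0 0) (σ 0 1) (σ 11 0) (σ 10 0) (σ 1) (σ 23) (σ 7)) σ := by
  have h1B : (1 : ℕ).size ≤ B := h.size_le (e := 0) (by simp) (by omega)
  refine WP.seq (WP.set hσ (by simp [Expr.eval]) fun hσ' => ?_)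
  simp only [Expr.eval] at hσ' ⊢
  refine WP.forLoop (fun r τ => SameOff [13, 14, 15, 21, 22] σ τ ∧ τ 15 0 =
      ∑ r ∈ Finset.range r, rowLoss (σ 11 0) (σ 10 0) (fun j => σ 1 (σ 0 1 * r + j)) (σ 23) (σ 7)
        (σ 0 1)) (σ 0 0) hσ' (h.rows.trans h.iter)
      (h.size_le (e := 1) (by simpa using h.rows.trans h.len_le) (by omega)) ?_ ?_ ?_ ?_
  · exact ⟨((SameOff.refl _ σ).write (by simp) _ _).write (by simp) _ _, by simp [write_apply]⟩
  · rintro j τ ⟨hs, -⟩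
    simp [Expr.eval, hs 0 (by simp)]
  · rintro r τ hr hτ ⟨hs, hM⟩ hrv
    refine WP.seq (WP.set hτ h1B fun hτ₁ => ?_)
    refine WP.seq (WP.set hτ₁ (by simp [Expr.eval]) fun hτ₂ => ?_)
    simp only [Expr.eval] at hτ₁ hτ₂ ⊢
    have hs₂ : SameOff [13, 14, 15, 21, 22] σ (write (write τ 13 0 1) 14 0 0) :=
      (hs.write (by simp) _ _).write (by simp) _ _
    refine WP.seq (WP.forLoop (fun j υ => SameOff [13, 14, 15, 21, 22] σ υ ∧ υ 22 0 = r ∧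
      υ 15 0 = τ 15 0 ∧
      υ 13 0 = prefixProd (σ 11 0) (σ 10 0) (fun j => σ 1 (σ 0 1 * r + j)) (σ 7) j ∧
      υ 14 0 = rowLoss (σ 11 0) (σ 10 0) (fun j => σ 1 (σ 0 1 * r + j)) (σ 23) (σ 7) j)
      (σ 0 1) hτ₂ (h.cols.trans h.iter)
      (h.size_le (e := 1) (by simpa using h.cols.trans h.len_le) (by omega)) ?_ ?_ ?_ ?_)
    · refine ⟨hs₂.write (by simp) _ _, ?_, ?_, ?_, ?_⟩ <;>
        simp [write_apply, hrv, prefixProd, rowLoss]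
    · rintro j υ ⟨hs, -⟩
      simp [Expr.eval, hs 0 (by simp)]
    · rintro j υ hj hυ ⟨hs, hrv, h15, h13, h14⟩ hjv
      -- The row penalty is updated before the running product, since column `j` is charged with the
      -- product over strictly earlier columns.
      have hval : (Expr.add (mul (var 14) (var 11))
          (mul (get 1 (add (mul (get 0 (lit 1)) (var 22)) (var 21)))
            (mul (mul (get 23 (var 21)) (get 7 (var 21))) (var 13)))).eval υ =
          rowLoss (σ 11 0) (σ 10 0) (fun j => σ 1 (σ 0 1 * r + j)) (σ 23) (σ 7) (j + 1) := by
        simp [Expr.eval, rowLoss, hs 0, hs 1, hs 11, hs 23, hs 7, hrv, h13, h14, hjv]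
      refine WP.seq (WP.set hυ ?_ fun hυ₁ => ?_)
      · rw [hval]
        exact h.size_le (rowLoss_le_pow h.scale h.base h.one_le (fun _ => h.matrix _) h.weights
          h.vec h.len_le (hj.trans_le h.cols : j + 1 ≤ L)) (by omega)
      · rw [hval] at hυ₁ ⊢
        have hval' : ∀ v, (mul (var 13) (add (var 11)
            (mul (get 1 (add (mul (get 0 (lit 1)) (var 22)) (var 21)))
              (mul (sub (var 10) (lit 1)) (get 7 (var 21)))))).eval (write υ 14 0 v) =
            prefixProd (σ 11 0) (σ 10 0) (fun j => σ 1 (σ 0 1 * r + j)) (σ 7) (j + 1) := by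
          simp [Expr.eval, prefixProd, write_apply, hs 0, hs 1, hs 10, hs 11, hs 7, hrv, h13, hjv]
        refine WP.set hυ₁ ?_ ?_
        · simp only [Expr.eval] at hval' ⊢
          rw [hval']
          refine h.size_le ((prefixProd_le h.scale h.base h.one_le (fun _ => h.matrix _)
            h.vec (j + 1)).trans (?_ : _ ≤ G ^ (2 * L))) (by omega)
          rw [← pow_two, ← pow_mul]
          have := h.cols
          exact Nat.pow_le_pow_right h.one_le (by omega)
        · simp only [Expr.eval] at hval' ⊢
          rw [hval']
          refine ⟨by simp [write_apply, hjv],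
            ((hs.write (by simp) _ _).write (by simp) _ _).write (by simp) _ _, ?_, ?_, ?_, ?_⟩ <;>
            simp [write_apply, hrv, h15]
    · rintro υ ⟨hs, hrv, h15, h13, h14⟩ hυ
      have hval : (Expr.add (var 15) (var 14)).eval υ = ∑ r ∈ Finset.range (r + 1),
          rowLoss (σ 11 0) (σ 10 0) (fun j => σ 1 (σ 0 1 * r + j)) (σ 23) (σ 7) (σ 0 1) := by
        rw [Finset.sum_range_succ, ← hM, ← h14, ← h15]
        simp [Expr.eval]
      refine WP.set hυ ?_ ?_
      · rw [hval]
        exact h.size_le (sum_rowLoss_le_pow h.scale h.base h.one_le h.matrix h.weights h.vec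
          h.len_le (hr.trans_le h.rows : r + 1 ≤ L) h.cols) (by omega)
      · rw [hval]
        exact ⟨by simp [write_apply, hrv],
          (hs.write (by simp) _ _).write (by simp) _ _, by simp [write_apply, Expr.eval]⟩
  · rintro τ ⟨hs, hM⟩
    exact ⟨hs, hM⟩

end PackingRounding

/-! ### Correctness of the greedy rounding and of the scaling to integers -/

namespace PackingRounding

open PackingRounding.Expr PackingRounding.Prog

variable {B ℓ G L : ℕ} {σ : ℕ → ℕ → ℕ}

theorem roundNat_le {m n N β K : ℕ} {A C U : ℕ → ℕ} (hN : N ≤ G) (hU : ∀ j, U j ≤ G) (i j : ℕ) :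
    roundNat m n N β K A C U i j ≤ G := by
  induction i with
  | zero => exact hU j
  | succ i ih =>
    rw [roundNat]
    split_ifs <;> rw [Function.update_apply] <;> split_ifs <;> first | exact hN | exact ih | simp

/-- Needed so that array `7` equals the scaled solution as a whole function, and not only below `n`,
when it is reloaded for the next `β`. -/
theorem roundNat_eq_zero {m n N β K : ℕ} {A C U : ℕ → ℕ} (hU : ∀ j, n ≤ j → U j = 0) {i : ℕ}
    (hi : i ≤ n) : ∀ j, n ≤ j → roundNat m n N β K A C U i j = 0 := by
  induction i with
  | zero => exact hU
  | succ i ih =>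
    intro j hj
    have hji : j ≠ i := by omega
    rw [roundNat]
    split_ifs <;> rw [Function.update_of_ne hji] <;> exact ih (by omega) j hj

/-- Rounds the vector in array `7` as `roundNat` does. -/
def roundProg : Prog :=
  forLoop 20 (get 0 (lit 1)) <|
    seq (set 7 (var 20) (lit 0)) <| seq lossProg <| seq (assign 16 (var 15)) <|
    seq (set 7 (var 20) (var 11)) <| seq lossProg <|
    cond (sub (add (mul (var 12) (get 23 (var 20))) (var 16)) (var 15)) skip
      (set 7 (var 20) (lit 0))

theorem LossBounds.of_sameOff {τ : ℕ → ℕ → ℕ} (h : LossBounds B ℓ G L σ)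
    (hs : SameOff [7, 13, 14, 15, 16, 20, 21, 22] σ τ) (h7 : ∀ j, τ 7 j ≤ G) :
    LossBounds B ℓ G L τ := by
  obtain ⟨h1, h2, h3, h4, h5, h6, h8, h9, h10, h11, h12⟩ := h
  constructor <;> simp_all [hs 0, hs 1, hs 10, hs 11, hs 23]

theorem update_le {U : ℕ → ℕ} (hU : ∀ j, U j ≤ G) {v : ℕ} (hv : v ≤ G) (i j : ℕ) :
    Function.update U i v j ≤ G := by
  rw [Function.update_apply]
  split_ifs
  exacts [hv, hU j]

theorem wp_roundProg (hσ : SizeLE B σ) (h : LossBounds B ℓ G L σ) :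
    WP B ℓ roundProg (fun τ => SameOff [7, 13, 14, 15, 16, 20, 21, 22] σ τ ∧
      τ 7 = roundNat (σ 0 0) (σ 0 1) (σ 11 0) (σ 10 0) (σ 12 0) (σ 1) (σ 23) (σ 7) (σ 0 1)) σ := by
  refine WP.forLoop (fun i τ => SameOff [7, 13, 14, 15, 16, 20, 21, 22] σ τ ∧
    τ 7 = roundNat (σ 0 0) (σ 0 1) (σ 11 0) (σ 10 0) (σ 12 0) (σ 1) (σ 23) (σ 7) i) (σ 0 1)
    hσ (h.cols.trans h.iter)
    (h.size_le (e := 1) (by simpa using h.cols.trans h.len_le) (by omega)) ?_ ?_ ?_ ?_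
  · exact ⟨(SameOff.refl _ σ).write (by simp) _ _, by simp [write_apply, roundNat]⟩
  · rintro i τ ⟨hs, -⟩
    simp [Expr.eval, hs 0]
  · rintro i τ hi hτ ⟨hs, h7⟩ hiv
    set V := roundNat (σ 0 0) (σ 0 1) (σ 11 0) (σ 10 0) (σ 12 0) (σ 1) (σ 23) (σ 7) i with hV
    have hVG : ∀ j, V j ≤ G := roundNat_le h.scale h.vec i
    refine WP.seq (WP.set hτ (by simp [Expr.eval]) fun hτ₁ => ?_)
    simp only [Expr.eval, hiv] at hτ₁ ⊢
    have hs₁ : SameOff [7, 13, 14, 15, 16, 20, 21, 22] σ (write τ 7 i 0) :=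
      hs.write (by simp) _ _
    have h7₁ : write τ 7 i 0 7 = Function.update V i 0 := by simp [write_apply, h7]
    have hb₁ : LossBounds B ℓ G L (write τ 7 i 0) := h.of_sameOff hs₁ (by
      rw [h7₁]; exact update_le hVG (Nat.zero_le _) i)
    refine WP.seq ((wp_lossProg hτ₁ hb₁).mono ?_)
    rintro υ ⟨hsυ, hM₀⟩ hυ
    have hs₂ : SameOff [7, 13, 14, 15, 16, 20, 21, 22] σ υ := hs₁.trans hsυ (by simp)
    rw [h7₁, hs₁ 0 (by simp), hs₁ 11 (by simp), hs₁ 10 (by simp), hs₁ 1 (by simp),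
      hs₁ 23 (by simp)] at hM₀
    have hiυ : υ 20 0 = i := by rw [hsυ 20 (by simp)]; simp [write_apply, hiv]
    have h7υ : υ 7 = Function.update V i 0 := by rw [hsυ 7 (by simp), h7₁]
    refine WP.seq (WP.set hυ (hυ 15 0) fun hυ₁ => ?_)
    simp only [Expr.eval] at hυ₁ ⊢
    refine WP.seq (WP.set hυ₁ (hυ₁ 11 0) fun hυ₂ => ?_)
    have hiυ' : write υ 16 0 (υ 15 0) 20 0 = i := by simp [write_apply, hiυ]
    have h11υ' : write υ 16 0 (υ 15 0) 11 0 = σ 11 0 := by simp [write_apply, hs₂ 11]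
    simp only [Expr.eval, hiυ', h11υ'] at hυ₂ ⊢
    set ρ := write (write υ 16 0 (υ 15 0)) 7 i (σ 11 0) with hρ
    have hsρ : SameOff [7, 13, 14, 15, 16, 20, 21, 22] σ ρ :=
      (hs₂.write (by simp) _ _).write (by simp) _ _
    have h7ρ : ρ 7 = Function.update V i (σ 11 0) := by simp [hρ, write_apply, h7υ]
    have h16ρ : ρ 16 0 = υ 15 0 := by simp [hρ, write_apply]
    have h20ρ : ρ 20 0 = i := by simp [hρ, write_apply, hiυ]
    have hbρ : LossBounds B ℓ G L ρ := h.of_sameOff hsρ (by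
      rw [h7ρ]; exact update_le hVG h.scale i)
    refine WP.seq ((wp_lossProg hυ₂ hbρ).mono ?_)
    rintro π ⟨hsπ, hM₁⟩ hπ
    have hs₃ : SameOff [7, 13, 14, 15, 16, 20, 21, 22] σ π := hsρ.trans hsπ (by simp)
    rw [h7ρ, hsρ 0 (by simp), hsρ 11 (by simp), hsρ 10 (by simp), hsρ 1 (by simp),
      hsρ 23 (by simp)] at hM₁
    have h20π : π 20 0 = i := by rw [hsπ 20 (by simp), h20ρ]
    have h7π : π 7 = Function.update V i (σ 11 0) := by rw [hsπ 7 (by simp), h7ρ]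
    have h16π : π 16 0 = υ 15 0 := by rw [hsπ 16 (by simp), h16ρ]
    -- Truncated subtraction is nonzero exactly when the strict inequality in `roundNat` holds. The
    -- value is only tested, never stored, so it needs no bit-length bound.
    have htest : (sub (add (mul (var 12) (get 23 (var 20))) (var 16)) (var 15)).eval π =
        (σ 12 0 * σ 23 i + totalLoss (σ 0 0) (σ 0 1) (σ 11 0) (σ 10 0) (σ 1) (σ 23)
          (Function.update V i 0)) - totalLoss (σ 0 0) (σ 0 1) (σ 11 0) (σ 10 0) (σ 1) (σ 23)
          (Function.update V i (σ 11 0)) := by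
      simp [Expr.eval, hs₃ 12, hs₃ 23, h20π, h16π, hM₀, hM₁]
    -- The cell already holds `N` from the second evaluation, so acceptance requires no action.
    refine WP.cond hπ (fun ht => WP.skip hπ ?_) (fun ht => WP.set hπ (by simp [Expr.eval]) ?_)
    · rw [htest] at ht
      refine ⟨h20π, hs₃.write (by simp) _ _, ?_⟩
      rw [roundNat, ← hV, if_pos (by omega), ← h7π]
      simp [write_apply]
    · rw [htest] at ht
      simp only [Expr.eval, h20π]
      refine ⟨by simp [write_apply, h20π],
        (hs₃.write (by simp) _ _).write (by simp) _ _, ?_⟩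
      rw [roundNat, ← hV, if_neg (by omega)]
      simp [write_apply, h7π]
  · exact fun τ hτ => hτ

/-- Computes the common denominators and the scaled weights and fractional solution. -/
def scaleProg : Prog :=
  seq (assign 8 (lit 1)) <| seq (assign 9 (lit 1)) <| seq
    (forLoop 20 (get 0 (lit 1)) <| seq
      (assign 8 (mul (var 8) (get 3 (var 20)))) (assign 9 (mul (var 9) (get 5 (var 20)))))
    (forLoop 20 (get 0 (lit 1)) <| seq
      (set 23 (var 20) (mul (get 2 (var 20)) (div (var 8) (get 3 (var 20)))))
      (set 24 (var 20) (mul (get 4 (var 20)) (div (var 9) (get 5 (var 20))))))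

/-- The numerators, scaled to the common denominator `∏ j < n, d j`. -/
def scaled (n : ℕ) (v d : ℕ → ℕ) : ℕ → ℕ :=
  fun i => if i < n then v i * ((∏ j ∈ Finset.range n, d j) / d i) else 0

/-- The partial products need bounds of their own because each is stored. Arrays `23` and `24` must
start at zero, since `scaled` vanishes from index `n` on and those cells are never written. -/
theorem wp_scaleProg (hσ : SizeLE B σ) (hn : σ 0 1 ≤ ℓ) (hB : 1 ≤ B)
    (h3 : ∀ i ≤ σ 0 1, (∏ j ∈ Finset.range i, σ 3 j).size ≤ B)
    (h5 : ∀ i ≤ σ 0 1, (∏ j ∈ Finset.range i, σ 5 j).size ≤ B)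
    (h23 : ∀ i, (scaled (σ 0 1) (σ 2) (σ 3) i).size ≤ B)
    (h24 : ∀ i, (scaled (σ 0 1) (σ 4) (σ 5) i).size ≤ B)
    (hz : σ 23 = fun _ => 0) (hz' : σ 24 = fun _ => 0) :
    WP B ℓ scaleProg (fun τ => SameOff [8, 9, 20, 23, 24] σ τ ∧
      τ 8 0 = ∏ j ∈ Finset.range (σ 0 1), σ 3 j ∧ τ 9 0 = ∏ j ∈ Finset.range (σ 0 1), σ 5 j ∧
      τ 23 = scaled (σ 0 1) (σ 2) (σ 3) ∧ τ 24 = scaled (σ 0 1) (σ 4) (σ 5)) σ := by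
  have h1B : (1 : ℕ).size ≤ B := by simpa using hB
  refine WP.seq (WP.set hσ h1B fun hσ₁ => ?_)
  refine WP.seq (WP.set hσ₁ h1B fun hσ₂ => ?_)
  simp only [Expr.eval] at hσ₁ hσ₂ ⊢
  refine WP.seq (WP.forLoop (fun i τ => SameOff [8, 9, 20] σ τ ∧
      τ 8 0 = ∏ j ∈ Finset.range i, σ 3 j ∧ τ 9 0 = ∏ j ∈ Finset.range i, σ 5 j)
      (σ 0 1) hσ₂ hn (hσ 0 1) ?_ ?_ ?_ ?_)
  · exact ⟨(((SameOff.refl _ σ).write (by simp) _ _).write (by simp) _ _).write (by simp) _ _,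
      by simp [write_apply], by simp [write_apply]⟩
  · rintro i τ ⟨hs, -⟩
    simp [Expr.eval, hs 0]
  · rintro i τ hi hτ ⟨hs, h8, h9⟩ hiv
    have hval : (mul (var 8) (get 3 (var 20))).eval τ = ∏ j ∈ Finset.range (i + 1), σ 3 j := by
      simp [Expr.eval, h8, hiv, hs 3, Finset.prod_range_succ]
    refine WP.seq (WP.set hτ (by rw [hval]; exact h3 _ hi) fun hτ₁ => ?_)
    rw [hval] at hτ₁ ⊢
    have hval' : ∀ v, (mul (var 9) (get 5 (var 20))).eval (write τ 8 ((lit 0).eval τ) v) =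
        ∏ j ∈ Finset.range (i + 1), σ 5 j := by
      simp [Expr.eval, h9, hiv, hs 5, Finset.prod_range_succ, write_apply]
    refine WP.set hτ₁ (by rw [hval']; exact h5 _ hi) ?_
    rw [hval']
    exact ⟨by simp [write_apply, hiv],
      ((hs.write (by simp) _ _).write (by simp) _ _).write (by simp) _ _,
      by simp [write_apply, Expr.eval], by simp [write_apply, Expr.eval]⟩
  · rintro τ ⟨hs, h8, h9⟩ hτ
    refine WP.forLoop (fun i υ => SameOff [8, 9, 20, 23, 24] σ υ ∧ υ 8 0 = τ 8 0 ∧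
      υ 9 0 = τ 9 0 ∧
      υ 23 = (fun j => if j < i then scaled (σ 0 1) (σ 2) (σ 3) j else 0) ∧
      υ 24 = (fun j => if j < i then scaled (σ 0 1) (σ 4) (σ 5) j else 0))
      (σ 0 1) hτ hn (hσ 0 1) ?_ ?_ ?_ ?_
    · refine ⟨?_, by simp [write_apply], by simp [write_apply], ?_, ?_⟩
      · intro a ha
        simp only [List.mem_cons, List.not_mem_nil, or_false, not_or] at ha
        rw [write_apply, if_neg ha.2.2.1]
        exact hs a (by simp [ha])
      · simp [write_apply, hs 23, hz]
      · simp [write_apply, hs 24, hz']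
    · rintro i υ ⟨hs, -⟩
      simp [Expr.eval, hs 0]
    · rintro i υ hi hυ ⟨hs, h8', h9', h23', h24'⟩ hiv
      have hval : (mul (get 2 (var 20)) (div (var 8) (get 3 (var 20)))).eval υ =
          scaled (σ 0 1) (σ 2) (σ 3) i := by
        simp [Expr.eval, h8', h8, hiv, hs 2, hs 3, scaled, hi]
      refine WP.seq (WP.set hυ (by rw [hval]; exact h23 i) fun hυ₁ => ?_)
      rw [hval] at hυ₁ ⊢
      have hval' : ∀ v, (mul (get 4 (var 20)) (div (var 9) (get 5 (var 20)))).eval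
          (write υ 23 ((var 20).eval υ) v) = scaled (σ 0 1) (σ 4) (σ 5) i := by
        simp [Expr.eval, h9', h9, hiv, hs 4, hs 5, scaled, hi, write_apply]
      refine WP.set hυ₁ (by rw [hval']; exact h24 i) ?_
      rw [hval']
      have key : ∀ f : ℕ → ℕ, Function.update (fun j => if j < i then f j else 0) i (f i) =
          fun j => if j < i + 1 then f j else 0 := by
        intro f
        funext j
        rcases eq_or_ne j i with rfl | hji
        · simp
        · rw [Function.update_of_ne hji]
          exact if_congr (by omega) rfl rfl
      refine ⟨by simp [write_apply, hiv],
        ((hs.write (by simp) _ _).write (by simp) _ _).write (by simp) _ _,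
        by simp [write_apply, h8'], by simp [write_apply, h9'], ?_, ?_⟩
      · simp [write_apply, Expr.eval, hiv, h23', key]
      · simp [write_apply, Expr.eval, hiv, h24', key]
    · rintro υ ⟨hs, h8', h9', h23', h24'⟩
      refine ⟨hs, h8'.trans h8, h9'.trans h9, ?_, ?_⟩
      · rw [h23']
        funext j
        by_cases hj : j < σ 0 1 <;> simp [scaled, hj]
      · rw [h24']
        funext j
        by_cases hj : j < σ 0 1 <;> simp [scaled, hj]

end PackingRounding

/-! ### The search over all values of `β` -/

namespace PackingRounding

open PackingRounding.Expr PackingRounding.Prog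

variable {B ℓ G L : ℕ} {σ : ℕ → ℕ → ℕ}

theorem wp_powLoop {a : ℕ} (ha : a ≠ 12) (ha' : a ≠ 20) {e : Expr} (k : ℕ) (hσ : SizeLE B σ)
    (hk : k ≤ ℓ) (hkB : k.size ≤ B) (he : ∀ τ, SameOff [12, 20] σ τ → e.eval τ = k)
    (hB : ∀ i ≤ k, (σ 12 0 * σ a 0 ^ i).size ≤ B) :
    WP B ℓ (forLoop 20 e (assign 12 (mul (var 12) (var a))))
      (fun τ => SameOff [12, 20] σ τ ∧ τ 12 0 = σ 12 0 * σ a 0 ^ k) σ := by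
  refine WP.forLoop (fun i τ => SameOff [12, 20] σ τ ∧ τ 12 0 = σ 12 0 * σ a 0 ^ i) k hσ hk hkB
    ⟨(SameOff.refl _ σ).write (by simp) _ _, by simp [write_apply]⟩ (fun i τ h => he τ h.1) ?_
    fun τ h => h
  rintro i τ hi hτ ⟨hs, h12⟩ hiv
  have hval : (mul (var 12) (var a)).eval τ = σ 12 0 * σ a 0 ^ (i + 1) := by
    simp [Expr.eval, h12, hs a (by simp [ha, ha']), pow_succ, mul_assoc]
  refine WP.set hτ (by rw [hval]; exact hB _ hi) ?_
  rw [hval]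
  exact ⟨by simp [write_apply, hiv], (hs.write (by simp) _ _).write (by simp) _ _,
    by simp [write_apply, Expr.eval]⟩

/-- Sets `β`, `N` and `K = N ^ n * β ^ min b (m + n)` and loads the scaled fractional solution. -/
def setupProg : Prog :=
  seq (assign 10 (add (var 25) (lit 1))) <|
  seq (assign 11 (mul (var 10) (var 9))) <|
  seq (assign 12 (lit 1)) <|
  seq (forLoop 20 (get 0 (lit 1)) (assign 12 (mul (var 12) (var 11)))) <|
  seq (forLoop 20 (sub (add (get 0 (lit 0)) (get 0 (lit 1)))
      (sub (add (get 0 (lit 0)) (get 0 (lit 1))) (get 0 (lit 2))))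
    (assign 12 (mul (var 12) (var 10)))) <|
  forLoop 20 (get 0 (lit 1)) (set 7 (var 20) (get 24 (var 20)))

/-- The bounds under which the roundings with all `β` run. -/
structure TrialBounds (B ℓ G L : ℕ) (σ : ℕ → ℕ → ℕ) : Prop where
  rows : σ 0 0 ≤ L
  cols : σ 0 1 ≤ L
  matrix : ∀ t, σ 1 t ≤ 1
  weights : ∀ j, σ 23 j ≤ G
  sol : ∀ j, σ 24 j ≤ G
  sol_zero : ∀ j, σ 0 1 ≤ j → σ 24 j = 0
  -- The largest `β` tried is `6 * m + 1`; the next field bounds the corresponding `N = β * Q`.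
  base : 6 * L + 1 ≤ G
  scale : (6 * L + 1) * σ 9 0 ≤ G
  iter : 6 * L + 1 ≤ ℓ
  pow_lt : G ^ (3 * L + 4) < 2 ^ B

theorem TrialBounds.one_le (h : TrialBounds B ℓ G L σ) : 1 ≤ G := by
  have := h.base
  omega

theorem TrialBounds.size_le (h : TrialBounds B ℓ G L σ) {v e : ℕ} (hv : v ≤ G ^ e)
    (he : e ≤ 3 * L + 4) : v.size ≤ B :=
  size_le_of_le_pow h.one_le h.pow_lt hv he

theorem TrialBounds.of_sameOff {τ : ℕ → ℕ → ℕ} (h : TrialBounds B ℓ G L σ) {l : List ℕ}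
    (hs : SameOff l σ τ) (hl : ∀ a ∈ [0, 1, 9, 23, 24], a ∉ l) : TrialBounds B ℓ G L τ := by
  obtain ⟨h1, h2, h3, h4, h5, h6, h7, h8, h9, h10⟩ := h
  have e0 := hs 0 (hl 0 (by simp))
  have e1 := hs 1 (hl 1 (by simp))
  have e9 := hs 9 (hl 9 (by simp))
  have e23 := hs 23 (hl 23 (by simp))
  have e24 := hs 24 (hl 24 (by simp))
  constructor <;> simp_all

theorem wp_setupProg (hσ : SizeLE B σ) (h : TrialBounds B ℓ G L σ) (ht : σ 25 0 ≤ 6 * L)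
    (h7 : ∀ j, σ 0 1 ≤ j → σ 7 j = 0) :
    WP B ℓ setupProg (fun τ => SameOff [7, 10, 11, 12, 20] σ τ ∧ τ 10 0 = σ 25 0 + 1 ∧
      τ 11 0 = (σ 25 0 + 1) * σ 9 0 ∧ τ 7 = σ 24 ∧
      τ 12 0 = ((σ 25 0 + 1) * σ 9 0) ^ σ 0 1 * (σ 25 0 + 1) ^ min (σ 0 2) (σ 0 0 + σ 0 1)) σ := by
  have hG := h.one_le
  have hrows := h.rows
  have hcols := h.cols
  have hiter := h.iter
  have hbase := h.base
  have hβ : σ 25 0 + 1 ≤ G := by omega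
  have hN : (σ 25 0 + 1) * σ 9 0 ≤ G :=
    (Nat.mul_le_mul_right _ (by omega)).trans h.scale
  refine WP.seq (WP.set hσ (h.size_le (e := 1) (by simpa [Expr.eval] using hβ) (by omega))
    fun hσ₁ => ?_)
  simp only [Expr.eval] at hσ₁ ⊢
  set σ₁ := write σ 10 0 (σ 25 0 + 1) with hσ₁e
  have hv₁ : (mul (var 10) (var 9)).eval σ₁ = (σ 25 0 + 1) * σ 9 0 := by
    simp [Expr.eval, hσ₁e, write_apply]
  refine WP.seq (WP.set hσ₁ (by
    rw [hv₁]; exact h.size_le (e := 1) (by simpa using hN) (by omega)) fun hσ₂ => ?_)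
  rw [hv₁] at hσ₂ ⊢
  simp only [Expr.eval] at hσ₂ ⊢
  refine WP.seq (WP.set hσ₂ (h.size_le (e := 0) (by simp [Expr.eval]) (by omega)) fun hσ₃ => ?_)
  simp only [Expr.eval] at hσ₃ ⊢
  set σ₃ := write (write σ₁ 11 0 ((σ 25 0 + 1) * σ 9 0)) 12 0 1 with hσ₃e
  have hs₃ : SameOff [7, 10, 11, 12, 20] σ σ₃ :=
    (((SameOff.refl _ σ).write (by simp) _ _).write (by simp) _ _).write (by simp) _ _
  have e10 : σ₃ 10 0 = σ 25 0 + 1 := by simp [hσ₃e, hσ₁e, write_apply]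
  have e11 : σ₃ 11 0 = (σ 25 0 + 1) * σ 9 0 := by simp [hσ₃e, write_apply]
  have e12 : σ₃ 12 0 = 1 := by simp [hσ₃e, write_apply]
  have e7 : σ₃ 7 = σ 7 := by simp [hσ₃e, hσ₁e, write_apply]
  -- The exponents are at most `n ≤ L` and `min b (m + n) ≤ 2 * L`; without the cap on `b` the
  -- threshold could have exponentially many bits.
  have pow_bound : ∀ i j, i ≤ L → j ≤ 2 * L →
      ((σ 25 0 + 1) * σ 9 0) ^ i * (σ 25 0 + 1) ^ j ≤ G ^ (3 * L) := by
    intro i j hi hj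
    calc _ ≤ G ^ i * G ^ j := Nat.mul_le_mul (Nat.pow_le_pow_left hN i) (Nat.pow_le_pow_left hβ j)
      _ = G ^ (i + j) := (pow_add _ _ _).symm
      _ ≤ _ := Nat.pow_le_pow_right hG (by omega)
  refine WP.seq ((wp_powLoop (by norm_num) (by norm_num) (σ 0 1) hσ₃ (by omega) (hσ 0 1)
    (fun τ hs => by simp [Expr.eval, hs 0, hs₃ 0]) (fun i hi => ?_)).mono ?_)
  · rw [e12, e11, one_mul]
    exact h.size_le (by simpa using pow_bound i 0 (by omega) (by omega)) (by omega)
  rintro τ ⟨hs, hτ12⟩ hτ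
  rw [e12, e11, one_mul] at hτ12
  have hs₄ : SameOff [7, 10, 11, 12, 20] σ τ := hs₃.trans hs (by simp)
  have e10' : τ 10 0 = σ 25 0 + 1 := by rw [hs 10 (by simp), e10]
  refine WP.seq ((wp_powLoop (by norm_num) (by norm_num) (min (σ 0 2) (σ 0 0 + σ 0 1)) hτ
    (by omega) ?_ (fun υ hs => ?_) (fun i hi => ?_)).mono ?_)
  · refine h.size_le (e := 1) ?_ (by omega)
    rw [pow_one]
    omega
  -- With truncated subtraction, `s - (s - b)` is `min b s`.
  · simp only [Expr.eval, hs 0 (by simp), hs₄ 0 (by simp)]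
    omega
  · rw [hτ12, e10']
    exact h.size_le (pow_bound _ i hcols (by omega)) (by omega)
  rintro υ ⟨hs', hυ12⟩ hυ
  rw [hτ12, e10'] at hυ12
  have hs₅ : SameOff [7, 10, 11, 12, 20] σ υ := hs₄.trans hs' (by simp)
  have e10'' : υ 10 0 = σ 25 0 + 1 := by rw [hs' 10 (by simp), e10']
  have e11'' : υ 11 0 = (σ 25 0 + 1) * σ 9 0 := by
    rw [hs' 11 (by simp), hs 11 (by simp), e11]
  have e7'' : υ 7 = σ 7 := by rw [hs' 7 (by simp), hs 7 (by simp), e7]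
  refine WP.forLoop (fun i π => SameOff [7, 20] υ π ∧
    π 7 = fun j => if j < i then σ 24 j else σ 7 j) (σ 0 1) hυ (by omega) (hσ 0 1) ?_ ?_ ?_ ?_
  · exact ⟨(SameOff.refl _ υ).write (by simp) _ _, by simp [write_apply, e7'']⟩
  · rintro i π ⟨hs, -⟩
    simp [Expr.eval, hs 0, hs₅ 0]
  · rintro i π hi hπ ⟨hs, h7π⟩ hiv
    refine WP.set hπ (hπ _ _) ?_
    simp only [Expr.eval, hiv, hs 24 (by simp), hs₅ 24 (by simp)]
    refine ⟨by simp [write_apply, hiv], (hs.write (by simp) _ _).write (by simp) _ _, ?_⟩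
    rw [write_apply, if_neg (by norm_num), write_apply, if_pos rfl, h7π]
    funext j
    rcases eq_or_ne j i with rfl | hji
    · simp
    · rw [Function.update_of_ne hji]
      exact if_congr (by omega) rfl rfl
  · rintro π ⟨hs, h7π⟩
    refine ⟨hs₅.trans hs (by simp), ?_, ?_, ?_, ?_⟩
    · rw [hs 10 (by simp), e10'']
    · rw [hs 11 (by simp), e11'']
    · rw [h7π]
      funext j
      by_cases hj : j < σ 0 1
      · simp [hj]
      · simp [hj, h7 j (by omega), h.sol_zero j (by omega)]
    · rw [hs 12 (by simp), hυ12]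

/-- The 0-1 vector to which the procedure rounds with `β = t + 1`, for the scaled weights `C`, the
scaled fractional solution `X` and its common denominator `Q`. -/
def roundedVec (m n b Q : ℕ) (A C X : ℕ → ℕ) (t i : ℕ) : ℕ :=
  roundNat m n ((t + 1) * Q) (t + 1) (((t + 1) * Q) ^ n * (t + 1) ^ min b (m + n)) A C X n i /
    ((t + 1) * Q)

/-- The rounded vector that belongs to array contents. -/
def memVec (σ : ℕ → ℕ → ℕ) : ℕ → ℕ → ℕ :=
  roundedVec (σ 0 0) (σ 0 1) (σ 0 2) (σ 9 0) (σ 1) (σ 23) (σ 24)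

/-- Records the vector in array `7` as the output if it is better than the best one so far. -/
def recordProg : Prog :=
  seq (assign 17 (lit 0)) <|
  seq (forLoop 20 (get 0 (lit 1)) (assign 17 (add (var 17)
    (mul (get 23 (var 20)) (div (get 7 (var 20)) (var 11)))))) <|
  cond (sub (var 17) (var 18))
    (seq (assign 18 (var 17))
      (forLoop 20 (get 0 (lit 1)) (set 6 (var 20) (div (get 7 (var 20)) (var 11)))))
    skip

/-- The two alternatives are a strict improvement, which overwrites the output, and none, which
leaves the best value and the output alone. -/
theorem wp_recordProg (hσ : SizeLE B σ) (h : LossBounds B ℓ G L σ) :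
    WP B ℓ recordProg (fun τ => SameOff [6, 17, 18, 20] σ τ ∧
      ((τ 18 0 = ∑ i ∈ Finset.range (σ 0 1), σ 23 i * (σ 7 i / σ 11 0) ∧ σ 18 0 < τ 18 0 ∧
          ∀ i < σ 0 1, τ 6 i = σ 7 i / σ 11 0) ∨
        (∑ i ∈ Finset.range (σ 0 1), σ 23 i * (σ 7 i / σ 11 0) ≤ σ 18 0 ∧ τ 18 0 = σ 18 0 ∧
          τ 6 = σ 6))) σ := by
  have hcols := h.cols
  have hiter := h.iter
  refine WP.seq (WP.set hσ (by simp [Expr.eval]) fun hσ₁ => ?_)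
  simp only [Expr.eval] at hσ₁ ⊢
  refine WP.seq (WP.forLoop (fun i τ => SameOff [17, 20] σ τ ∧
    τ 17 0 = ∑ i ∈ Finset.range i, σ 23 i * (σ 7 i / σ 11 0)) (σ 0 1) hσ₁ (by omega) (hσ 0 1)
    ?_ ?_ ?_ ?_)
  · exact ⟨((SameOff.refl _ σ).write (by simp) _ _).write (by simp) _ _, by simp [write_apply]⟩
  · rintro i τ ⟨hs, -⟩
    simp [Expr.eval, hs 0]
  · rintro i τ hi hτ ⟨hs, h17⟩ hiv
    have hval : (add (var 17) (mul (get 23 (var 20)) (div (get 7 (var 20)) (var 11)))).eval τ =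
        ∑ i ∈ Finset.range (i + 1), σ 23 i * (σ 7 i / σ 11 0) := by
      simp [Expr.eval, Finset.sum_range_succ, h17, hiv, hs 23, hs 7, hs 11]
    refine WP.set hτ ?_ ?_
    · rw [hval]
      refine h.size_le (e := 3) ?_ (by omega)
      calc _ ≤ ∑ _i ∈ Finset.range (i + 1), G * G := Finset.sum_le_sum fun j _ =>
            Nat.mul_le_mul (h.weights j) ((Nat.div_le_self _ _).trans (h.vec j))
        _ = (i + 1) * (G * G) := by simp
        _ ≤ G * (G * G) := Nat.mul_le_mul_right _ (by have := h.len_le; omega)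
        _ = G ^ 3 := by ring
    · rw [hval]
      exact ⟨by simp [write_apply, hiv], (hs.write (by simp) _ _).write (by simp) _ _,
        by simp [write_apply, Expr.eval]⟩
  · rintro τ ⟨hs, h17⟩ hτ
    have hs' : SameOff [6, 17, 18, 20] σ τ := (SameOff.refl _ σ).trans hs (by simp)
    refine WP.cond hτ (fun ht => ?_) (fun ht => WP.skip hτ ?_)
    · simp only [Expr.eval, hs 18 (by simp)] at ht
      refine WP.seq (WP.set hτ (hτ _ _) fun hτ₁ => ?_)
      simp only [Expr.eval] at hτ₁ ⊢
      refine WP.forLoop (fun i υ => SameOff [6, 17, 18, 20] σ υ ∧ υ 18 0 = τ 17 0 ∧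
        ∀ j < i, υ 6 j = σ 7 j / σ 11 0) (σ 0 1) hτ₁ (by omega) (hσ 0 1) ?_ ?_ ?_ ?_
      · exact ⟨(hs'.write (by simp) _ _).write (by simp) _ _, by simp [write_apply], by simp⟩
      · rintro i υ ⟨hs, -⟩
        simp [Expr.eval, hs 0]
      · rintro i υ hi hυ ⟨hs, h18, h6⟩ hiv
        have hval : (div (get 7 (var 20)) (var 11)).eval υ = σ 7 i / σ 11 0 := by
          simp [Expr.eval, hs 7, hs 11, hiv]
        refine WP.set hυ (by
          rw [hval]; exact (Nat.size_le_size (Nat.div_le_self _ _)).trans (hσ _ _)) ?_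
        rw [hval]
        refine ⟨by simp [write_apply, hiv], (hs.write (by simp) _ _).write (by simp) _ _,
          by simp [write_apply, h18], fun j hj => ?_⟩
        simp only [Expr.eval, hiv, write_apply]
        rcases eq_or_ne j i with rfl | hji
        · simp
        · simpa [hji] using h6 j (by omega)
      · rintro υ ⟨hs, h18, h6⟩
        exact ⟨hs, Or.inl ⟨by rw [h18, h17], by omega, h6⟩⟩
    · simp only [Expr.eval, hs 18 (by simp)] at ht
      exact ⟨hs', Or.inr ⟨by omega, by rw [hs 18 (by simp)], hs 6 (by simp)⟩⟩

/-- The rounding program. -/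
def mainProg : Prog :=
  seq scaleProg <|
  forLoop 25 (add (mul (lit 6) (get 0 (lit 0))) (lit 1)) <|
    seq setupProg <| seq roundProg recordProg

/-- What the loop over `β` achieves. -/
structure BestRounding (n : ℕ) (C : ℕ → ℕ) (y : ℕ → ℕ → ℕ) (T : ℕ) (z : ℕ → ℕ) : Prop where
  -- The zero vector is the initial output; it stays if no candidate has positive value, because
  -- only strict improvements are recorded.
  eq : (∀ i < n, z i = 0) ∨ ∃ t < T, ∀ i < n, z i = y t i
  le : ∀ t < T, ∑ i ∈ Finset.range n, C i * y t i ≤ ∑ i ∈ Finset.range n, C i * z i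

theorem wp_trialLoop (hσ : SizeLE B σ) (h : TrialBounds B ℓ G L σ) (h6 : σ 6 = fun _ => 0)
    (h7 : σ 7 = fun _ => 0) (h18 : σ 18 0 = 0) :
    WP B ℓ (forLoop 25 (add (mul (lit 6) (get 0 (lit 0))) (lit 1)) <|
        seq setupProg <| seq roundProg recordProg)
      (fun τ => BestRounding (σ 0 1) (σ 23) (memVec σ) (6 * σ 0 0 + 1) (τ 6)) σ := by
  have hrows := h.rows
  have hbase := h.base
  refine WP.forLoop (fun t τ =>
    SameOff [6, 7, 10, 11, 12, 13, 14, 15, 16, 17, 18, 20, 21, 22, 25] σ τ ∧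
    (∀ j, σ 0 1 ≤ j → τ 7 j = 0) ∧
    τ 18 0 = ∑ i ∈ Finset.range (σ 0 1), σ 23 i * τ 6 i ∧
    BestRounding (σ 0 1) (σ 23) (memVec σ) t (τ 6)) (6 * σ 0 0 + 1) hσ
    (by have := h.iter; omega) (h.size_le (e := 1) (by rw [pow_one]; omega) (by omega))
    ?_ ?_ ?_ fun τ hτ => hτ.2.2.2
  · refine ⟨(SameOff.refl _ σ).write (by simp) _ _, ?_, ?_, ?_, ?_⟩ <;>
      simp [write_apply, h6, h7, h18]
  · rintro t τ ⟨hs, -⟩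
    simp [Expr.eval, hs 0]
  rintro t τ ht hτ ⟨hs, h7τ, h18τ, hbest⟩ htv
  have e0 : τ 0 = σ 0 := hs 0 (by simp)
  have e1 : τ 1 = σ 1 := hs 1 (by simp)
  have e9 : τ 9 = σ 9 := hs 9 (by simp)
  have e23 : τ 23 = σ 23 := hs 23 (by simp)
  have e24 : τ 24 = σ 24 := hs 24 (by simp)
  have hτb : TrialBounds B ℓ G L τ := h.of_sameOff hs (by simp)
  refine WP.seq ((wp_setupProg hτ hτb (by omega) (by rwa [e0])).mono ?_)
  rintro υ ⟨hsυ, h10, h11, h7υ, h12⟩ hυ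
  rw [htv] at h10 h11 h12
  rw [e24] at h7υ
  rw [e9] at h11 h12
  rw [e0] at h12
  have hυb : LossBounds B ℓ G L υ := by
    constructor
    · rw [hsυ 0 (by simp), e0]; exact h.rows
    · rw [hsυ 0 (by simp), e0]; exact h.cols
    · rw [hsυ 1 (by simp), e1]; exact h.matrix
    · rw [h7υ]; exact h.sol
    · rw [hsυ 23 (by simp), e23]; exact h.weights
    · rw [h10]; omega
    · rw [h11]; exact (Nat.mul_le_mul_right _ (by omega)).trans h.scale
    · exact h.one_le
    · omega
    · have := h.iter; omega
    · exact h.pow_lt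
  refine WP.seq ((wp_roundProg hυ hυb).mono ?_)
  rintro π ⟨hsπ, h7π⟩ hπ
  rw [hsυ 0 (by simp), hsυ 1 (by simp), hsυ 23 (by simp), h10, h11, h12, h7υ, e0, e1, e23] at h7π
  have hπb : LossBounds B ℓ G L π := hυb.of_sameOff hsπ (by
    rw [h7π]
    exact roundNat_le ((Nat.mul_le_mul_right _ (by omega)).trans h.scale) h.sol _)
  have hsπ' : SameOff [6, 7, 10, 11, 12, 13, 14, 15, 16, 17, 18, 20, 21, 22, 25] σ π :=
    (hs.trans hsυ (by simp)).trans hsπ (by simp)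
  refine (wp_recordProg hπ hπb).mono ?_
  rintro ρ ⟨hsρ, hρ⟩
  have e11 : π 11 0 = (t + 1) * σ 9 0 := by rw [hsπ 11 (by simp), h11]
  have ediv : ∀ i, π 7 i / π 11 0 = memVec σ t i := by
    intro i
    rw [e11, h7π]
    rfl
  have e18 : π 18 0 = τ 18 0 := by rw [hsπ 18 (by simp), hsυ 18 (by simp)]
  have e6 : π 6 = τ 6 := by rw [hsπ 6 (by simp), hsυ 6 (by simp)]
  have e0' : π 0 = σ 0 := hsπ' 0 (by simp)
  have e23' : π 23 = σ 23 := hsπ' 23 (by simp)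
  simp only [ediv, e18, e6, e0', e23'] at hρ
  refine ⟨?_, (hsπ'.trans hsρ (by simp)).write (by simp) _ _, ?_, ?_⟩
  · rw [hsρ 25 (by simp), hsπ 25 (by simp), hsυ 25 (by simp), htv]
  · intro j hj
    rw [write_apply, if_neg (by norm_num), hsρ 7 (by simp), h7π]
    exact roundNat_eq_zero h.sol_zero le_rfl j hj
  · simp only [write_apply, if_neg (show (18 : ℕ) ≠ 25 by norm_num),
      if_neg (show (6 : ℕ) ≠ 25 by norm_num)]
    rcases hρ with ⟨h18, hlt, h6ρ⟩ | ⟨hle, h18, h6ρ⟩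
    · have hsum : ∑ i ∈ Finset.range (σ 0 1), σ 23 i * ρ 6 i =
          ∑ i ∈ Finset.range (σ 0 1), σ 23 i * memVec σ t i :=
        Finset.sum_congr rfl fun i hi => by rw [h6ρ i (Finset.mem_range.1 hi)]
      refine ⟨by rw [h18, hsum], Or.inr ⟨t, by omega, h6ρ⟩, fun t' ht' => ?_⟩
      rw [hsum]
      rcases Nat.lt_succ_iff_lt_or_eq.1 ht' with h' | rfl
      · have := hbest.le t' h'
        omega
      · exact le_rfl
    · rw [h18, h6ρ]
      refine ⟨h18τ, ?_, fun t' ht' => ?_⟩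
      · rcases hbest.eq with h' | ⟨t', ht', h'⟩
        · exact Or.inl h'
        · exact Or.inr ⟨t', by omega, h'⟩
      · rcases Nat.lt_succ_iff_lt_or_eq.1 ht' with h' | rfl
        · exact hbest.le t' h'
        · omega

end PackingRounding

/-! ### Bit lengths in terms of the input length, and the run of the whole program -/

namespace PackingRounding

section Run

variable {m n : ℕ} (I : Input m n)

theorem ofFin_apply {v : Fin n → ℕ} (i : Fin n) : ofFin v i = v i := by simp [ofFin]

theorem ofFin_induction {v : Fin n → ℕ} {p : ℕ → Prop} (h0 : p 0) (hv : ∀ i, p (v i)) (i : ℕ) :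
    p (ofFin v i) := by
  unfold ofFin
  split_ifs
  exacts [hv _, h0]

theorem Input.sum_size_le :
    (∑ i, (I.c i).num.size ≤ I.length ∧ ∑ i, (I.c i).den.size ≤ I.length) ∧
      ∑ i, (I.x i).num.size ≤ I.length ∧ ∑ i, (I.x i).den.size ≤ I.length := by
  simp only [Input.length, Finset.sum_add_distrib]
  omega

theorem Input.load_matrix_le (t : ℕ) : I.load 1 t ≤ 1 := by
  unfold Input.load
  exact ofFin_induction (p := (· ≤ 1)) (Nat.zero_le 1) (fun i => by split_ifs <;> simp) t

theorem size_le_of_sum_le {v : Fin n → ℕ} {L : ℕ} (h : ∑ i, (v i).size ≤ L) (i : ℕ) :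
    (ofFin v i).size ≤ L :=
  ofFin_induction (p := fun x => x.size ≤ L) (by simp) (fun i =>
    (Finset.single_le_sum (f := fun i => (v i).size) (fun _ _ => Nat.zero_le _)
      (Finset.mem_univ i)).trans h) i

theorem prod_le_two_pow_sum_size (f : ℕ → ℕ) (s : Finset ℕ) :
    ∏ j ∈ s, f j ≤ 2 ^ ∑ j ∈ s, (f j).size := by
  rw [← Finset.prod_pow_eq_pow_sum]
  exact Finset.prod_le_prod' fun j _ => (Nat.lt_size_self _).le

theorem prod_ofFin_le {v : Fin n → ℕ} {L : ℕ} (h : ∑ i, (v i).size ≤ L) {i : ℕ} (hi : i ≤ n) :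
    ∏ j ∈ Finset.range i, ofFin v j ≤ 2 ^ L := by
  refine (prod_le_two_pow_sum_size _ _).trans (Nat.pow_le_pow_right (by norm_num) ?_)
  calc _ ≤ ∑ j ∈ Finset.range n, (ofFin v j).size :=
        Finset.sum_le_sum_of_subset (Finset.range_subset_range.2 hi)
    _ = ∑ j : Fin n, (v j).size := by
        rw [Finset.sum_range]
        exact Finset.sum_congr rfl fun j _ => by rw [ofFin_apply]
    _ ≤ L := h

/-- One factor `2 ^ L` bounds the numerator. The other bounds the product of all denominators, whose
bit lengths sum to at most `L`. -/
theorem scaled_ofFin_le {v d : Fin n → ℕ} {L : ℕ} (hv : ∑ i, (v i).size ≤ L)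
    (hd : ∑ i, (d i).size ≤ L) (i : ℕ) : scaled n (ofFin v) (ofFin d) i ≤ 2 ^ (2 * L) := by
  unfold scaled
  split_ifs
  · rw [two_mul, pow_add]
    exact Nat.mul_le_mul (Nat.size_le.1 (size_le_of_sum_le hv i)).le
      ((Nat.div_le_self _ _).trans (prod_ofFin_le hd le_rfl))
  · exact Nat.zero_le _

theorem size_le_of_le_two_pow {v e B : ℕ} (hv : v ≤ 2 ^ e) (he : e < B) : v.size ≤ B :=
  Nat.size_le.2 (hv.trans_lt (Nat.pow_lt_pow_right (by norm_num) he))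

/-- The scaled integer weights of an input. -/
def Input.intWeights : ℕ → ℕ := scaled n (I.load 2) (I.load 3)

/-- The scaled fractional solution of an input. -/
def Input.intSol : ℕ → ℕ := scaled n (I.load 4) (I.load 5)

/-- The common denominator of the fractional solution of an input. -/
def Input.solDen : ℕ := ∏ j ∈ Finset.range n, I.load 5 j

/-- The vector to which the procedure rounds with `β = t + 1`. -/
def Input.candidate : ℕ → ℕ → ℕ :=
  roundedVec m n I.b I.solDen (I.load 1) I.intWeights I.intSol

theorem Input.load_sizeLE : SizeLE (I.length + 2) I.load := by
  obtain ⟨⟨h2, h3⟩, h4, h5⟩ := I.sum_size_le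
  intro a i
  match a with
  | 0 =>
    refine ofFin_induction (p := fun x => x.size ≤ I.length + 2) (by simp) (fun j => ?_) i
    have hm : m.size ≤ I.length := Nat.size_le.2 (Nat.lt_two_pow_self.trans_le
      (Nat.pow_le_pow_right (by norm_num) (by unfold Input.length; omega)))
    have hn : n.size ≤ I.length := Nat.size_le.2 (Nat.lt_two_pow_self.trans_le
      (Nat.pow_le_pow_right (by norm_num) (by unfold Input.length; omega)))
    have hb : I.b.size ≤ I.length := by unfold Input.length; omega
    fin_cases j <;> simp <;> omega
  | 1 => exact size_le_of_le_two_pow (e := 0) (I.load_matrix_le i) (by omega)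
  | 2 => exact (size_le_of_sum_le h2 i).trans (by omega)
  | 3 => exact (size_le_of_sum_le h3 i).trans (by omega)
  | 4 => exact (size_le_of_sum_le h4 i).trans (by omega)
  | 5 => exact (size_le_of_sum_le h5 i).trans (by omega)
  | a + 6 => simp [Input.load]

theorem Input.wp_mainProg :
    WP ((2 * I.length + 3) * (3 * I.length + 4) + 1) (6 * I.length + 1) mainProg
      (fun τ => BestRounding n I.intWeights I.candidate (6 * m + 1) (τ 6)) I.load := by
  obtain ⟨⟨h2, h3⟩, h4, h5⟩ := I.sum_size_le
  have hm : m ≤ I.length := by unfold Input.length; omega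
  have hn : n ≤ I.length := by unfold Input.length; omega
  set L := I.length with hL
  set B := (2 * L + 3) * (3 * L + 4) + 1 with hB
  have hBL : 2 * L + 4 ≤ B := by rw [hB]; nlinarith
  have hσ : SizeLE B I.load := fun a i => (I.load_sizeLE a i).trans (by omega)
  have l0 : I.load 0 0 = m := by simp [Input.load, ofFin]
  have l1 : I.load 0 1 = n := by simp [Input.load, ofFin]
  have l2 : I.load 0 2 = I.b := by simp [Input.load, ofFin]
  have hpow : 2 ^ L ≤ 2 ^ (2 * L + 3) := Nat.pow_le_pow_right (by norm_num) (by omega)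
  -- This bounds `N = β * Q`, and fixes the choice `G = 2 ^ (2 * L + 3)`; then `G ^ (3 * L + 4) < 2
  -- ^ B` dictates `B`.
  have hscale : (6 * L + 1) * 2 ^ L ≤ 2 ^ (2 * L + 3) := by
    have : L < 2 ^ L := Nat.lt_two_pow_self
    calc (6 * L + 1) * 2 ^ L ≤ (8 * 2 ^ L) * 2 ^ L := Nat.mul_le_mul_right _ (by omega)
      _ = 2 ^ (2 * L + 3) := by ring
  refine WP.seq ((wp_scaleProg hσ (by omega) (by omega) ?_ ?_ ?_ ?_ rfl rfl).mono ?_)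
  · intro i hi
    exact size_le_of_le_two_pow (prod_ofFin_le h3 (by omega)) (by omega)
  · intro i hi
    exact size_le_of_le_two_pow (prod_ofFin_le h5 (by omega)) (by omega)
  · intro i
    rw [l1]
    exact size_le_of_le_two_pow (scaled_ofFin_le h2 h3 i) (by omega)
  · intro i
    rw [l1]
    exact size_le_of_le_two_pow (scaled_ofFin_le h4 h5 i) (by omega)
  rintro τ ⟨hs, -, h9, h23, h24⟩ hτ
  rw [l1] at h9 h23 h24
  have e0 : τ 0 = I.load 0 := hs 0 (by simp)
  have e1 : τ 1 = I.load 1 := hs 1 (by simp)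
  have hle : 2 ^ (2 * L) ≤ 2 ^ (2 * L + 3) := Nat.pow_le_pow_right (by norm_num) (by omega)
  have hb : TrialBounds B (6 * L + 1) (2 ^ (2 * L + 3)) L τ := by
    constructor
    · rw [e0, l0]; exact hm
    · rw [e0, l1]; exact hn
    · rw [e1]; exact I.load_matrix_le
    · rw [h23]; exact fun j => (scaled_ofFin_le h2 h3 j).trans hle
    · rw [h24]; exact fun j => (scaled_ofFin_le h4 h5 j).trans hle
    · rw [h24, e0, l1]
      intro j hj
      simp [scaled, Nat.not_lt.2 hj]
    · exact (Nat.le_mul_of_pos_right _ (by positivity)).trans hscale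
    · rw [h9]; exact (Nat.mul_le_mul_left _ (prod_ofFin_le h5 le_rfl)).trans hscale
    · exact le_rfl
    · rw [← pow_mul, hB]
      exact Nat.pow_lt_pow_right (by norm_num) (by omega)
  refine (wp_trialLoop hτ hb (hs 6 (by simp)) (hs 7 (by simp))
    (by rw [hs 18 (by simp)]; rfl)).mono fun υ hυ => ?_
  have hmem : memVec τ = I.candidate := by
    unfold memVec Input.candidate Input.intWeights Input.intSol Input.solDen
    rw [e0, e1, l0, l1, l2, h9, h23, h24]
  rw [hmem, e0, l0, l1, h23] at hυ
  exact hυ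

/-- The polynomial that bounds the running time of `mainProg`. -/
noncomputable def timeBound : Polynomial ℕ :=
  mainProg.costBound ((2 * .X + 3) * (3 * .X + 4) + 1) (6 * .X + 1)

/-- The program never flips a coin, so a single output `z` serves all sequences of random bits. -/
theorem Input.exists_run_mainProg : ∃ z : ℕ → ℕ,
    BestRounding n I.intWeights I.candidate (6 * m + 1) z ∧
      ∀ ω, RunsTo mainProg I (timeBound.eval I.length) ω fun y => y = fun i : Fin n => (z i : ℝ) := by
  obtain ⟨τ, -, hτ, hrun⟩ := I.wp_mainProg
  refine ⟨τ 6, hτ, fun ω => ?_⟩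
  obtain ⟨t, ht, hrun⟩ := hrun ω 0
  refine ⟨_, t, hrun, ?_, rfl⟩
  simpa [timeBound, Prog.eval_costBound] using ht

end Run

end PackingRounding

namespace PackingRounding

/-! ### The rounding procedure in real arithmetic -/

section Potential

/-- The product of `1 + (β - 1) u l` over the first `j` columns of a row with indicator vector
`w`. -/
noncomputable def rowFactor (β : ℝ) (w u : ℕ → ℝ) (j : ℕ) : ℝ :=
  ∏ l ∈ Finset.range j, (1 + w l * ((β - 1) * u l))

/-- The sum of the penalties of all rows. -/
noncomputable def penalty (m n : ℕ) (β : ℝ) (w : ℕ → ℕ → ℝ) (c u : ℕ → ℝ) : ℝ :=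
  ∑ r ∈ Finset.range m, ∑ j ∈ Finset.range n, w r j * (c j * u j * rowFactor β (w r) u j)

/-- The objective minus the penalties: a pessimistic estimator for the value of a rounding. -/
noncomputable def potential (m n b : ℕ) (β : ℝ) (w : ℕ → ℕ → ℝ) (c u : ℕ → ℝ) : ℝ :=
  ∑ j ∈ Finset.range n, c j * u j - penalty m n β w c u / β ^ b

open Classical in
/-- Round the first coordinates of `u` to `0` or `1`, one after the other, such that the potential
does not decrease. -/
noncomputable def roundReal (m n b : ℕ) (β : ℝ) (w : ℕ → ℕ → ℝ) (c u : ℕ → ℝ) : ℕ → ℕ → ℝ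
  | 0 => u
  | i + 1 =>
    let v := roundReal m n b β w c u i
    if penalty m n β w c (Function.update v i 1) <
        β ^ b * c i + penalty m n β w c (Function.update v i 0)
    then Function.update v i 1 else Function.update v i 0

variable {m n b : ℕ} {β : ℝ} {w : ℕ → ℕ → ℝ} {c u : ℕ → ℝ}

theorem rowFactor_update_of_le (w u : ℕ → ℝ) {i j : ℕ} (hj : j ≤ i) (v : ℝ) :
    rowFactor β w (Function.update u i v) j = rowFactor β w u j :=
  Finset.prod_congr rfl fun l hl => by
    rw [Function.update_of_ne (by have := Finset.mem_range.1 hl; omega)]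

/-- Coordinate `i` enters term `j` at most once: not at all for `j > i` reversed, i.e. `j < i`; as
the factor `u j` for `j = i`; and in one factor of the product for `j > i`. -/
theorem exists_affine_term (w c u : ℕ → ℝ) (i j : ℕ) : ∃ a d : ℝ, ∀ v,
    w j * (c j * Function.update u i v j * rowFactor β w (Function.update u i v) j) =
      a + d * v := by
  rcases lt_trichotomy j i with hj | rfl | hj
  · refine ⟨w j * (c j * u j * rowFactor β w u j), 0, fun v => ?_⟩
    rw [rowFactor_update_of_le w u hj.le, Function.update_of_ne hj.ne]
    ring
  · refine ⟨0, w j * (c j * rowFactor β w u j), fun v => ?_⟩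
    rw [rowFactor_update_of_le w u le_rfl, Function.update_self]
    ring
  · set p := ∏ l ∈ (Finset.range j).erase i, (1 + w l * ((β - 1) * u l)) with hp
    have h : ∀ v, rowFactor β w (Function.update u i v) j = (1 + w i * ((β - 1) * v)) * p := by
      intro v
      unfold rowFactor
      rw [← Finset.mul_prod_erase _ _ (Finset.mem_range.2 hj), Function.update_self, hp]
      congr 1
      exact Finset.prod_congr rfl fun l hl => by
        rw [Function.update_of_ne (Finset.ne_of_mem_erase hl)]
    refine ⟨w j * (c j * u j * p), w j * (c j * u j * (w i * (β - 1) * p)), fun v => ?_⟩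
    rw [h, Function.update_of_ne hj.ne']
    ring

theorem exists_affine_penalty (m n : ℕ) (β : ℝ) (w : ℕ → ℕ → ℝ) (c u : ℕ → ℝ) (i : ℕ) :
    ∃ a d : ℝ, ∀ v, penalty m n β w c (Function.update u i v) = a + d * v := by
  choose a d h using fun r j => exists_affine_term (β := β) (w r) c u i j
  refine ⟨∑ r ∈ Finset.range m, ∑ j ∈ Finset.range n, a r j,
    ∑ r ∈ Finset.range m, ∑ j ∈ Finset.range n, d r j, fun v => ?_⟩
  unfold penalty
  simp only [h, Finset.sum_add_distrib, Finset.sum_mul]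

theorem sum_mul_update (c u : ℕ → ℝ) {i : ℕ} (hi : i < n) (v : ℝ) :
    ∑ j ∈ Finset.range n, c j * Function.update u i v j =
      ∑ j ∈ Finset.range n, c j * Function.update u i 0 j + c i * v := by
  have h : ∀ j, c j * Function.update u i v j =
      c j * Function.update u i 0 j + if j = i then c i * v else 0 := by
    intro j
    by_cases hj : j = i
    · subst hj; simp
    · simp [hj]
  simp [h, Finset.sum_add_distrib, hi]

theorem roundReal_succ_cases (m n b : ℕ) (β : ℝ) (w : ℕ → ℕ → ℝ) (c u : ℕ → ℝ) (i : ℕ) :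
    roundReal m n b β w c u (i + 1) = Function.update (roundReal m n b β w c u i) i 0 ∨
    roundReal m n b β w c u (i + 1) = Function.update (roundReal m n b β w c u i) i 1 ∧
      penalty m n β w c (Function.update (roundReal m n b β w c u i) i 1) <
        β ^ b * c i + penalty m n β w c (Function.update (roundReal m n b β w c u i) i 0) := by
  rw [roundReal]
  split_ifs with h
  · exact Or.inr ⟨rfl, h⟩
  · exact Or.inl rfl

theorem roundReal_mem_Icc (hu : ∀ j, 0 ≤ u j ∧ u j ≤ 1) (i j : ℕ) :
    0 ≤ roundReal m n b β w c u i j ∧ roundReal m n b β w c u i j ≤ 1 := by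
  induction i with
  | zero => exact hu j
  | succ i ih =>
    rcases roundReal_succ_cases m n b β w c u i with h | ⟨h, -⟩ <;>
      rw [h, Function.update_apply] <;> split_ifs <;> first | exact ih | norm_num

theorem roundReal_zero_or_one {i j : ℕ} (hj : j < i) :
    roundReal m n b β w c u i j = 0 ∨ roundReal m n b β w c u i j = 1 := by
  induction i with
  | zero => omega
  | succ i ih =>
    rcases eq_or_ne j i with rfl | hji
    · rcases roundReal_succ_cases m n b β w c u j with h | ⟨h, -⟩ <;> simp [h]
    · rcases roundReal_succ_cases m n b β w c u i with h | ⟨h, -⟩ <;>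
        rw [h, Function.update_of_ne hji] <;> exact ih (by omega)

/-- Along coordinate `i` the potential is affine with slope `c i - d / β ^ b`. The rounding rule
tests the sign of this slope and moves to the endpoint that does not lose. -/
theorem potential_le_roundReal (hβ : 0 < β) (hu : ∀ j, 0 ≤ u j ∧ u j ≤ 1) {i : ℕ} (hi : i ≤ n) :
    potential m n b β w c u ≤ potential m n b β w c (roundReal m n b β w c u i) := by
  induction i with
  | zero => exact le_rfl
  | succ i ih =>
    refine (ih (by omega)).trans ?_
    set v := roundReal m n b β w c u i with hv
    obtain ⟨a, d, had⟩ := exists_affine_penalty m n β w c v i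
    have hβb : 0 < β ^ b := pow_pos hβ b
    have hF : ∀ t, potential m n b β w c (Function.update v i t) =
        ∑ j ∈ Finset.range n, c j * Function.update v i 0 j + c i * t - (a + d * t) / β ^ b := by
      intro t
      rw [potential, sum_mul_update c v (by omega), had]
    have hvi : 0 ≤ v i ∧ v i ≤ 1 := roundReal_mem_Icc hu i i
    have hself : potential m n b β w c v = potential m n b β w c (Function.update v i (v i)) := by
      rw [Function.update_eq_self]
    have hd : d / β ^ b * β ^ b = d := div_mul_cancel₀ _ hβb.ne'
    rw [hself, roundReal, ← hv]
    split_ifs with h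
    · rw [had, had] at h
      rw [hF, hF, add_div, add_div, mul_div_right_comm, mul_div_right_comm]
      have : d / β ^ b ≤ c i := by rw [div_le_iff₀ hβb]; linarith
      nlinarith
    · rw [had, had] at h
      rw [hF, hF, add_div, add_div, mul_div_right_comm, mul_div_right_comm]
      have : c i ≤ d / β ^ b := by rw [le_div_iff₀ hβb]; linarith
      nlinarith

theorem rowFactor_nonneg (hβ : 1 ≤ β) {w : ℕ → ℝ} (hw : ∀ j, 0 ≤ w j) (hu : ∀ j, 0 ≤ u j) (j : ℕ) :
    0 ≤ rowFactor β w u j :=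
  Finset.prod_nonneg fun l _ => by
    have := mul_nonneg (hw l) (mul_nonneg (sub_nonneg.2 hβ) (hu l))
    linarith

theorem rowFactor_mono (hβ : 1 ≤ β) {w u u' : ℕ → ℝ} (hw : ∀ j, 0 ≤ w j) (hu : ∀ j, 0 ≤ u j)
    (huu' : ∀ j, u j ≤ u' j) (j : ℕ) : rowFactor β w u j ≤ rowFactor β w u' j :=
  Finset.prod_le_prod (fun l _ => by
    have := mul_nonneg (hw l) (mul_nonneg (sub_nonneg.2 hβ) (hu l))
    linarith) fun l _ => by
    have := mul_le_mul_of_nonneg_left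
      (mul_le_mul_of_nonneg_left (huu' l) (sub_nonneg.2 hβ)) (hw l)
    linarith

/-- Raising the coordinate `i` from `0` to `1` increases the penalty of each row `r` of `i` by at
least `c i` times the factor of that row. -/
theorem penalty_update_add_le (hβ : 1 ≤ β) (hw : ∀ r j, 0 ≤ w r j) (hc : ∀ j, 0 ≤ c j)
    (hu : ∀ j, 0 ≤ u j) {r i : ℕ} (hr : r < m) (hi : i < n) :
    penalty m n β w c (Function.update u i 0) + w r i * (c i * rowFactor β (w r) u i) ≤
      penalty m n β w c (Function.update u i 1) := by
  have h0 : ∀ j, 0 ≤ Function.update u i 0 j := by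
    intro j; rw [Function.update_apply]; split_ifs; exacts [le_rfl, hu j]
  have h01 : ∀ j, Function.update u i 0 j ≤ Function.update u i 1 j := by
    intro j; simp only [Function.update_apply]; split_ifs; exacts [zero_le_one, le_rfl]
  have hterm : ∀ s j, w s j * (c j * Function.update u i 0 j *
      rowFactor β (w s) (Function.update u i 0) j) ≤
      w s j * (c j * Function.update u i 1 j *
      rowFactor β (w s) (Function.update u i 1) j) := by
    intro s j
    refine mul_le_mul_of_nonneg_left (mul_le_mul (mul_le_mul_of_nonneg_left (h01 j) (hc j))
      (rowFactor_mono hβ (hw s) h0 h01 j) (rowFactor_nonneg hβ (hw s) h0 j)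
      (mul_nonneg (hc j) ((h0 j).trans (h01 j)))) (hw s j)
  have key : ∀ s ∈ Finset.range m, ∑ j ∈ Finset.range n, w s j * (c j * Function.update u i 0 j *
      rowFactor β (w s) (Function.update u i 0) j) +
        (if s = r then w r i * (c i * rowFactor β (w r) u i) else 0) ≤
      ∑ j ∈ Finset.range n, w s j * (c j * Function.update u i 1 j *
        rowFactor β (w s) (Function.update u i 1) j) := by
    intro s _
    by_cases hs : s = r
    · subst hs
      rw [if_pos rfl]
      calc _ = ∑ j ∈ Finset.range n, (w s j * (c j * Function.update u i 0 j *
            rowFactor β (w s) (Function.update u i 0) j) +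
            if j = i then w s i * (c i * rowFactor β (w s) u i) else 0) := by
            simp [Finset.sum_add_distrib, hi]
        _ ≤ _ := Finset.sum_le_sum fun j _ => by
            by_cases hj : j = i
            · subst hj
              rw [if_pos rfl, rowFactor_update_of_le _ _ le_rfl, rowFactor_update_of_le _ _ le_rfl]
              simp
            · rw [if_neg hj, add_zero]
              exact hterm s j
    · rw [if_neg hs, add_zero]
      exact Finset.sum_le_sum fun j _ => hterm s j
  have := Finset.sum_le_sum key
  rw [Finset.sum_add_distrib, Finset.sum_ite_eq' (Finset.range m) r,
    if_pos (Finset.mem_range.2 hr)] at this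
  exact this

/-- Once the first `i` coordinates are integral, the factor of a row is exactly `β ^ s` with `s` its
current number of ones. This link between penalty and row sum carries the induction that keeps `s ≤
b`. -/
theorem exists_rowSum_roundReal (hβ : 1 ≤ β) (hw : ∀ r j, w r j = 0 ∨ w r j = 1)
    (hc : ∀ j, 0 ≤ c j) (hu : ∀ j, 0 ≤ u j ∧ u j ≤ 1) {r : ℕ} (hr : r < m) {i : ℕ} (hi : i ≤ n) :
    ∃ s : ℕ, s ≤ b ∧ ∑ j ∈ Finset.range i, w r j * roundReal m n b β w c u i j = s ∧
      rowFactor β (w r) (roundReal m n b β w c u i) i = β ^ s := by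
  have hw0 : ∀ r j, 0 ≤ w r j := fun r j => by rcases hw r j with h | h <;> simp [h]
  induction i with
  | zero => exact ⟨0, Nat.zero_le b, by simp, by simp [rowFactor]⟩
  | succ i ih =>
    obtain ⟨s, hsb, hsum, hfac⟩ := ih (by omega)
    have hcases := roundReal_succ_cases m n b β w c u i
    set v := roundReal m n b β w c u i with hv
    have hv0 : ∀ j, 0 ≤ v j := fun j => (roundReal_mem_Icc hu i j).1
    have hsum' : ∀ t, ∑ j ∈ Finset.range (i + 1), w r j * Function.update v i t j =
        s + w r i * t := by
      intro t
      rw [Finset.sum_range_succ, Function.update_self, ← hsum]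
      congr 1
      exact Finset.sum_congr rfl fun j hj => by
        rw [Function.update_of_ne (Finset.mem_range.1 hj).ne]
    have hfac' : ∀ t, rowFactor β (w r) (Function.update v i t) (i + 1) =
        β ^ s * (1 + w r i * ((β - 1) * t)) := by
      intro t
      rw [← hfac, ← rowFactor_update_of_le (w r) v le_rfl t, rowFactor, Finset.prod_range_succ,
        Function.update_self, rowFactor]
    rcases hcases with h | ⟨h, hlt⟩
    · refine ⟨s, hsb, ?_, ?_⟩
      · rw [h, hsum']; simp
      · rw [h, hfac']; simp
    · rcases hw r i with h0 | h1
      · refine ⟨s, hsb, ?_, ?_⟩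
        · rw [h, hsum', h0]; simp
        · rw [h, hfac', h0]; simp
      · refine ⟨s + 1, ?_, ?_, ?_⟩
        · have hge := penalty_update_add_le hβ hw0 hc hv0 hr (show i < n by omega)
          rw [h1, hfac, one_mul] at hge
          -- The acceptance test bounds the increase of the penalty strictly by `c i * β ^ b`, while
          -- this row alone contributes `c i * β ^ s`; hence `s < b`.
          have hlt' : c i * β ^ s < c i * β ^ b := by linarith
          by_contra hcon
          have : β ^ b ≤ β ^ s := pow_le_pow_right₀ hβ (by omega)
          exact absurd hlt' (not_lt.2 (mul_le_mul_of_nonneg_left this (hc i)))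
        · rw [h, hsum', h1]; push_cast; ring
        · rw [h, hfac', h1]; ring

/-- Since `(β - 1) / β ≤ 1` and `1 + t ≤ exp t`, the product is at most the exponential of the row
sum, so at most `e ^ b`, uniformly in `β`. -/
theorem rowFactor_div_le (hβ : 1 ≤ β) {w x : ℕ → ℝ} (hw : ∀ j, 0 ≤ w j) (hx : ∀ j, 0 ≤ x j)
    (hb : ∑ j ∈ Finset.range n, w j * x j ≤ b) {j : ℕ} (hj : j ≤ n) :
    rowFactor β w (fun l => x l / β) j ≤ 3 ^ b := by
  have hβ0 : 0 < β := by linarith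
  have hle : ∀ l, (β - 1) * (x l / β) ≤ x l := by
    intro l
    rw [← mul_div_assoc, div_le_iff₀ hβ0]
    nlinarith [hx l]
  have hexp : ∀ l, 1 + w l * ((β - 1) * (x l / β)) ≤ Real.exp (w l * x l) := by
    intro l
    have h1 := Real.add_one_le_exp (w l * x l)
    have h2 := mul_le_mul_of_nonneg_left (hle l) (hw l)
    linarith
  calc rowFactor β w (fun l => x l / β) j ≤ ∏ l ∈ Finset.range j, Real.exp (w l * x l) :=
        Finset.prod_le_prod (fun l _ => by
          have := mul_nonneg (hw l) (mul_nonneg (sub_nonneg.2 hβ) (div_nonneg (hx l) hβ0.le))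
          linarith) fun l _ => hexp l
    _ = Real.exp (∑ l ∈ Finset.range j, w l * x l) := (Real.exp_sum _ _).symm
    _ ≤ Real.exp b := Real.exp_le_exp.2 ((Finset.sum_le_sum_of_subset_of_nonneg
        (Finset.range_subset_range.2 hj) fun l _ _ => mul_nonneg (hw l) (hx l)).trans hb)
    _ = Real.exp 1 ^ b := by rw [← Real.exp_nat_mul, mul_one]
    _ ≤ 3 ^ b := pow_le_pow_left₀ (Real.exp_pos 1).le
        (by have := Real.exp_one_lt_d9; linarith) b

/-- The gain is `O / β` and the penalty at most `3 ^ b * lam * O / β`. The condition `hpow` makes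
the penalty, divided by `β ^ b`, at most half the gain. -/
theorem le_potential_div (hβ : 1 ≤ β) (hw : ∀ r j, 0 ≤ w r j) (hc : ∀ j, 0 ≤ c j) {x : ℕ → ℝ}
    (hx : ∀ j, 0 ≤ x j) (hb : ∀ r < m, ∑ j ∈ Finset.range n, w r j * x j ≤ b) {lam : ℝ}
    (hlam : ∑ r ∈ Finset.range m, ∑ j ∈ Finset.range n, w r j * (c j * x j) ≤
      lam * ∑ j ∈ Finset.range n, c j * x j) (hpow : 2 * lam * 3 ^ b ≤ β ^ b) :
    (∑ j ∈ Finset.range n, c j * x j) / (2 * β) ≤ potential m n b β w c (fun j => x j / β) := by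
  have hβ0 : 0 < β := by linarith
  set O := ∑ j ∈ Finset.range n, c j * x j with hO
  have hO0 : 0 ≤ O := Finset.sum_nonneg fun j _ => mul_nonneg (hc j) (hx j)
  have hpen : penalty m n β w c (fun j => x j / β) ≤ 3 ^ b / β * (lam * O) := by
    refine le_trans ?_ (mul_le_mul_of_nonneg_left hlam (by positivity))
    rw [penalty, Finset.mul_sum]
    refine Finset.sum_le_sum fun r hr => ?_
    rw [Finset.mul_sum]
    refine Finset.sum_le_sum fun j hj => ?_
    have hf := rowFactor_div_le hβ (hw r) hx (hb r (Finset.mem_range.1 hr))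
      (Finset.mem_range.1 hj).le
    calc w r j * (c j * (x j / β) * rowFactor β (w r) (fun j => x j / β) j)
        ≤ w r j * (c j * (x j / β) * 3 ^ b) := mul_le_mul_of_nonneg_left
          (mul_le_mul_of_nonneg_left hf (mul_nonneg (hc j) (div_nonneg (hx j) hβ0.le))) (hw r j)
      _ = 3 ^ b / β * (w r j * (c j * x j)) := by ring
  have hgain : ∑ j ∈ Finset.range n, c j * (x j / β) = O / β := by
    rw [hO, Finset.sum_div]
    exact Finset.sum_congr rfl fun j _ => by ring
  have hβb : 0 < β ^ b := pow_pos hβ0 b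
  have hpen' : penalty m n β w c (fun j => x j / β) / β ^ b ≤ O / (2 * β) := by
    rw [div_le_iff₀ hβb]
    refine hpen.trans ?_
    calc 3 ^ b / β * (lam * O) = (2 * lam * 3 ^ b) * (O / (2 * β)) := by field_simp
      _ ≤ β ^ b * (O / (2 * β)) := mul_le_mul_of_nonneg_right hpow (by positivity)
      _ = _ := mul_comm _ _
  rw [potential, hgain]
  have : O / β = O / (2 * β) + O / (2 * β) := by field_simp; ring
  linarith

/-- The rounding of `x / β` has value at least half that of `x / β`. -/
theorem le_sum_roundReal (hβ : 1 ≤ β) (hw : ∀ r j, w r j = 0 ∨ w r j = 1) (hc : ∀ j, 0 ≤ c j)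
    {x : ℕ → ℝ} (hx : ∀ j, 0 ≤ x j ∧ x j ≤ 1)
    (hb : ∀ r < m, ∑ j ∈ Finset.range n, w r j * x j ≤ b) {lam : ℝ}
    (hlam : ∑ r ∈ Finset.range m, ∑ j ∈ Finset.range n, w r j * (c j * x j) ≤
      lam * ∑ j ∈ Finset.range n, c j * x j) (hpow : 2 * lam * 3 ^ b ≤ β ^ b) :
    (∑ j ∈ Finset.range n, c j * x j) / (2 * β) ≤
      ∑ j ∈ Finset.range n, c j * roundReal m n b β w c (fun j => x j / β) n j := by
  have hβ0 : 0 < β := by linarith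
  have hw0 : ∀ r j, 0 ≤ w r j := fun r j => by rcases hw r j with h | h <;> simp [h]
  have hu : ∀ j, 0 ≤ x j / β ∧ x j / β ≤ 1 := fun j =>
    ⟨div_nonneg (hx j).1 hβ0.le, (div_le_one hβ0).2 ((hx j).2.trans hβ)⟩
  refine (le_potential_div hβ hw0 hc (fun j => (hx j).1) hb hlam hpow).trans
    ((potential_le_roundReal hβ0 hu le_rfl).trans ?_)
  set y := roundReal m n b β w c (fun j => x j / β) n with hy
  have hy0 : ∀ j, 0 ≤ y j := fun j => (roundReal_mem_Icc hu n j).1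
  refine sub_le_self _ (div_nonneg ?_ (pow_pos hβ0 b).le)
  exact Finset.sum_nonneg fun r _ => Finset.sum_nonneg fun j _ => mul_nonneg (hw0 r j)
    (mul_nonneg (mul_nonneg (hc j) (hy0 j)) (rowFactor_nonneg hβ (hw0 r) hy0 j))

end Potential

/-! ### Agreement of the two procedures -/

section Agreement

variable {m n N β b : ℕ} {A C : ℕ → ℕ}

/-- The real-valued matrix that is stored row by row in `A`. -/
def matrixOf (n : ℕ) (A : ℕ → ℕ) (r j : ℕ) : ℝ := (A (n * r + j) : ℝ)

theorem prefixProd_cast (hN : 0 < N) (hβ : 1 ≤ β) (w U : ℕ → ℕ) (j : ℕ) :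
    (prefixProd N β w U j : ℝ) =
      N ^ j * rowFactor β (fun l => (w l : ℝ)) (fun l => (U l : ℝ) / N) j := by
  have hN' : (N : ℝ) ≠ 0 := by positivity
  induction j with
  | zero => simp [prefixProd, rowFactor]
  | succ j ih =>
    have hsucc : rowFactor β (fun l => (w l : ℝ)) (fun l => (U l : ℝ) / N) (j + 1) =
        rowFactor β (fun l => (w l : ℝ)) (fun l => (U l : ℝ) / N) j *
          (1 + w j * ((β - 1) * ((U j : ℝ) / N))) := Finset.prod_range_succ _ _
    rw [prefixProd, Nat.cast_mul, ih, hsucc]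
    generalize rowFactor β (fun l => (w l : ℝ)) (fun l => (U l : ℝ) / N) j = p
    push_cast [Nat.cast_sub hβ]
    field_simp
    ring

theorem rowLoss_cast (hN : 0 < N) (hβ : 1 ≤ β) (w C U : ℕ → ℕ) (j : ℕ) :
    (rowLoss N β w C U j : ℝ) = N ^ j * ∑ l ∈ Finset.range j, (w l : ℝ) * (C l * ((U l : ℝ) / N) *
      rowFactor β (fun l => (w l : ℝ)) (fun l => (U l : ℝ) / N) l) := by
  have hN' : (N : ℝ) ≠ 0 := by positivity
  induction j with
  | zero => simp [rowLoss]
  | succ j ih =>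
    rw [rowLoss, Finset.sum_range_succ]
    push_cast
    rw [ih, prefixProd_cast hN hβ]
    generalize ∑ l ∈ Finset.range j, (w l : ℝ) * (C l * ((U l : ℝ) / N) *
      rowFactor β (fun l => (w l : ℝ)) (fun l => (U l : ℝ) / N) l) = q
    field_simp
    ring

theorem totalLoss_cast (hN : 0 < N) (hβ : 1 ≤ β) (U : ℕ → ℕ) :
    (totalLoss m n N β A C U : ℝ) = N ^ n *
      penalty m n β (matrixOf n A) (fun j => (C j : ℝ)) (fun l => (U l : ℝ) / N) := by
  rw [totalLoss, penalty, Finset.mul_sum]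
  push_cast
  exact Finset.sum_congr rfl fun r _ => rowLoss_cast hN hβ _ _ _ _

theorem update_cast_div (U : ℕ → ℕ) (i v : ℕ) :
    (fun l => ((Function.update U i v l : ℕ) : ℝ) / N) =
      Function.update (fun l => (U l : ℝ) / N) i ((v : ℝ) / N) := by
  funext l
  rcases eq_or_ne l i with rfl | hl
  · simp
  · simp [hl]

/-- Both sides of the integer comparison are `N ^ n` times those of the real one, so the two
procedures take the same decisions. -/
theorem roundNat_cast (hN : 0 < N) (hβ : 1 ≤ β) (U : ℕ → ℕ) (i : ℕ) :
    (fun l => (roundNat m n N β (N ^ n * β ^ b) A C U i l : ℝ) / N) =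
      roundReal m n b β (matrixOf n A) (fun j => (C j : ℝ)) (fun l => (U l : ℝ) / N) i := by
  have hN' : (N : ℝ) ≠ 0 := by positivity
  induction i with
  | zero => rfl
  | succ i ih =>
    rw [roundNat, roundReal, ← ih]
    set V := roundNat m n N β (N ^ n * β ^ b) A C U i with hV
    have h1 := update_cast_div (N := N) V i N
    have h0 := update_cast_div (N := N) V i 0
    rw [div_self hN'] at h1
    rw [Nat.cast_zero, zero_div] at h0
    have hiff : totalLoss m n N β A C (Function.update V i N) <
        N ^ n * β ^ b * C i + totalLoss m n N β A C (Function.update V i 0) ↔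
        penalty m n β (matrixOf n A) (fun j => (C j : ℝ))
          (Function.update (fun l => (V l : ℝ) / N) i 1) <
        (β : ℝ) ^ b * C i + penalty m n β (matrixOf n A) (fun j => (C j : ℝ))
          (Function.update (fun l => (V l : ℝ) / N) i 0) := by
      rw [← Nat.cast_lt (α := ℝ)]
      push_cast
      rw [totalLoss_cast hN hβ, totalLoss_cast hN hβ, h1, h0, mul_assoc, ← mul_add]
      exact mul_lt_mul_iff_right₀ (by positivity)
    by_cases h : totalLoss m n N β A C (Function.update V i N) <
        N ^ n * β ^ b * C i + totalLoss m n N β A C (Function.update V i 0)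
    · rw [if_pos h, if_pos (hiff.1 h), h1]
    · rw [if_neg h, if_neg (fun h' => h (hiff.2 h')), h0]

end Agreement

end PackingRounding

namespace PackingRounding

/-! ### The linear program and the choice of `β` -/

section Final

variable {m n k b : ℕ} {p : ℝ}

theorem zeroOneMatrix_mulVec (S : Fin m → Finset (Fin n)) (z : Fin n → ℝ) (r : Fin m) :
    (zeroOneMatrix S *ᵥ z) r = ∑ i ∈ S r, z i := by
  simp [Matrix.mulVec, dotProduct, zeroOneMatrix]

/-- Double counting and comparison with a constant vector bound the penalties of an optimal
solution by its value. -/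
theorem IsLPOptimal.sum_le {S : Fin m → Finset (Fin n)} {c x : Fin n → ℝ} (hk : 1 ≤ k)
    (hS : ∀ r, (S r).card = k) (hp : 1 ≤ p) (hc : ∀ i, 1 / p ≤ c i ∧ c i ≤ 1)
    (hm : (m : ℝ) ≤ n * Real.logb 2 m / k) (hlog : 0 ≤ Real.logb 2 m)
    (h : IsLPOptimal (zeroOneMatrix S) b c x) :
    ∑ r, ∑ i ∈ S r, c i * x i ≤ min (m : ℝ) (p * Real.logb 2 m) * (c ⬝ᵥ x) := by
  obtain ⟨⟨hx, hb⟩, hmax⟩ := h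
  have hp0 : 0 < p := by linarith
  have hk0 : (0 : ℝ) < k := by exact_mod_cast hk
  have hc0 : ∀ i, 0 ≤ c i := fun i => (by positivity : (0 : ℝ) ≤ 1 / p).trans (hc i).1
  have hO0 : 0 ≤ c ⬝ᵥ x := Finset.sum_nonneg fun i _ => mul_nonneg (hc0 i) (hx i).1
  rw [min_mul_of_nonneg _ _ hO0]
  refine le_min ?_ ?_
  · calc ∑ r, ∑ i ∈ S r, c i * x i ≤ ∑ _r : Fin m, c ⬝ᵥ x :=
          Finset.sum_le_sum fun r _ => Finset.sum_le_univ_sum_of_nonneg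
            fun i => mul_nonneg (hc0 i) (hx i).1
      _ = m * (c ⬝ᵥ x) := by simp
  -- The constant vector `μ` is the largest feasible one: every row has exactly `k` ones. No row of
  -- `x` weighs more than `k * μ`, while the optimum is at least `n * μ / p`.
  · set μ : ℝ := min 1 (b / k) with hμ
    have hμ0 : 0 ≤ μ := le_min zero_le_one (by positivity)
    have hμb : k * μ ≤ b := by
      calc (k : ℝ) * μ ≤ k * (b / k) := mul_le_mul_of_nonneg_left (min_le_right _ _) hk0.le
        _ = b := by field_simp
    have hrow : ∀ r, ∑ i ∈ S r, c i * x i ≤ k * μ := by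
      intro r
      have h1 : ∑ i ∈ S r, c i * x i ≤ ∑ i ∈ S r, x i := Finset.sum_le_sum fun i _ =>
        mul_le_of_le_one_left (hx i).1 (hc i).2
      have h2 : ∑ i ∈ S r, x i ≤ k := by
        calc ∑ i ∈ S r, x i ≤ ∑ _i ∈ S r, (1 : ℝ) := Finset.sum_le_sum fun i _ => (hx i).2
          _ = k := by simp [hS r]
      have h3 : ∑ i ∈ S r, x i ≤ b := by simpa [zeroOneMatrix_mulVec] using hb r
      rw [hμ, mul_min_of_nonneg _ _ hk0.le, mul_one, mul_div_cancel₀ _ hk0.ne']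
      exact h1.trans (le_min h2 h3)
    have hz : (fun _ => μ) ∈ packingPolytope (zeroOneMatrix S) b := by
      refine ⟨fun i => ⟨hμ0, min_le_left _ _⟩, fun r => ?_⟩
      rw [zeroOneMatrix_mulVec]
      simpa [hS r] using hμb
    have hopt : n * μ / p ≤ c ⬝ᵥ x := by
      refine le_trans ?_ (hmax hz)
      calc (n : ℝ) * μ / p = ∑ _i : Fin n, 1 / p * μ := by simp; ring
        _ ≤ ∑ i, c i * μ := Finset.sum_le_sum fun i _ => mul_le_mul_of_nonneg_right (hc i).1 hμ0
    calc ∑ r, ∑ i ∈ S r, c i * x i ≤ ∑ _r : Fin m, k * μ := Finset.sum_le_sum fun r _ => hrow r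
      _ = m * (k * μ) := by simp
      _ ≤ n * Real.logb 2 m / k * (k * μ) := mul_le_mul_of_nonneg_right hm (by positivity)
      _ = p * Real.logb 2 m * (n * μ / p) := by field_simp
      _ ≤ p * Real.logb 2 m * (c ⬝ᵥ x) := mul_le_mul_of_nonneg_left hopt (by positivity)

theorem one_le_logb_two (hm : 2 ≤ m) : 1 ≤ Real.logb 2 m := by
  rw [Real.le_logb_iff_rpow_le (by norm_num) (by positivity), Real.rpow_one]
  exact_mod_cast hm

theorem one_le_approxFactor (hm : 2 ≤ m) : 1 ≤ approxFactor m b p := by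
  refine Real.one_le_rpow (le_max_of_le_right ?_) (by positivity)
  exact one_le_pow₀ (one_le_logb_two hm)

/-- Take `β = ⌈3 * θ⌉` with `θ = (2 * lam) ^ (1 / b')` and `b' = min b (m + n)`. Then `β ≤ 4 * θ`
and `θ ≤ 2 * approxFactor`, which yields the constant 16. -/
theorem exists_base (hm : 2 ≤ m) (hb : 1 ≤ b) (hp : 1 ≤ p) : ∃ t < 6 * m + 1,
    2 * min (m : ℝ) (p * Real.logb 2 m) * 3 ^ min b (m + n) ≤
        ((t + 1 : ℕ) : ℝ) ^ min b (m + n) ∧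
      2 * ((t + 1 : ℕ) : ℝ) ≤ 16 * approxFactor m b p := by
  have hlog := one_le_logb_two hm
  set lam := min (m : ℝ) (p * Real.logb 2 m) with hlam
  have hm' : (2 : ℝ) ≤ m := by exact_mod_cast hm
  have hlam1 : 1 ≤ lam := le_min (by linarith) (by nlinarith)
  have hlamm : lam ≤ m := min_le_left _ _
  set b' := min b (m + n) with hb'
  have hb'1 : 1 ≤ b' := le_min hb (by omega)
  have hb'0 : (0 : ℝ) < b' := by exact_mod_cast hb'1
  set θ : ℝ := (2 * lam) ^ (1 / (b' : ℝ)) with hθ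
  have hθ1 : 1 ≤ θ := Real.one_le_rpow (by linarith) (by positivity)
  have hθpow : θ ^ b' = 2 * lam := by
    rw [hθ, ← Real.rpow_natCast, ← Real.rpow_mul (by linarith), one_div_mul_cancel hb'0.ne',
      Real.rpow_one]
  have hθle : θ ≤ 2 * lam := by
    rw [← hθpow]
    exact le_self_pow₀ hθ1 (by omega)
  set q := ⌈3 * θ⌉₊ with hq
  have hq1 : 1 ≤ q := Nat.one_le_ceil_iff.2 (by linarith)
  have hqm : q ≤ 6 * m := Nat.ceil_le.2 (by push_cast; linarith)
  have hq3 : 3 * θ ≤ q := Nat.le_ceil _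
  have hq4 : (q : ℝ) ≤ 4 * θ := by
    have := (Nat.ceil_lt_add_one (show 0 ≤ 3 * θ by linarith)).le
    linarith
  refine ⟨q - 1, by omega, ?_, ?_⟩ <;> rw [Nat.sub_add_cancel hq1]
  · calc 2 * lam * 3 ^ b' = (3 * θ) ^ b' := by rw [mul_pow, hθpow, mul_comm]
      _ ≤ (q : ℝ) ^ b' := pow_le_pow_left₀ (by linarith) hq3 _
  · suffices θ ≤ 2 * approxFactor m b p by linarith
    rcases le_total b (m + n) with hle | hle
    · have e : b' = b := min_eq_left hle
      rw [hθ, e, Real.mul_rpow (by norm_num) (by linarith)]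
      have hexp : (1 : ℝ) / b ≤ 1 := by
        rw [div_le_one (by exact_mod_cast hb)]
        exact_mod_cast hb
      refine mul_le_mul ?_ (Real.rpow_le_rpow (by linarith) ?_ (by positivity)) (by positivity)
        (by norm_num)
      · calc (2 : ℝ) ^ (1 / (b : ℝ)) ≤ 2 ^ (1 : ℝ) :=
            Real.rpow_le_rpow_of_exponent_le (by norm_num) hexp
          _ = 2 := Real.rpow_one 2
      · exact (min_le_right _ _).trans (le_max_left _ _)
    · have e : b' = m + n := min_eq_right hle
      -- When `b` is capped, `θ ^ b' = 2 * lam ≤ 2 * m ≤ 2 ^ m ≤ 2 ^ b'`.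
      have h2 : θ ≤ 2 := by
        refine le_of_pow_le_pow_left₀ (n := b') (by omega) (by norm_num) ?_
        rw [hθpow]
        have h1 : m - 1 < 2 ^ (m - 1) := Nat.lt_two_pow_self
        have h3 : 2 * m ≤ 2 ^ m := by
          obtain ⟨d, rfl⟩ : ∃ d, m = d + 1 := ⟨m - 1, by omega⟩
          simp only [Nat.add_sub_cancel] at h1
          rw [pow_succ]
          omega
        have h4 : 2 ^ m ≤ 2 ^ b' := Nat.pow_le_pow_right (by norm_num) (by omega)
        have h5 : (2 * m : ℝ) ≤ 2 ^ b' := by exact_mod_cast h3.trans h4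
        linarith
      have := one_le_approxFactor (b := b) (p := p) hm
      linarith

/-- For some `β = t + 1` with `t ≤ 6 m`, every feasible 0-1 vector that is at least as good as the
rounding with `β` is a good rounding. -/
theorem exists_isGoodRounding_of_le {S : Fin m → Finset (Fin n)} {c x : Fin n → ℝ} (hk : 1 ≤ k)
    (hS : ∀ r, (S r).card = k) (hm2 : 2 ≤ m) (hb : 1 ≤ b) (hp : 1 ≤ p)
    (hc : ∀ i, 1 / p ≤ c i ∧ c i ≤ 1) (hm : (m : ℝ) ≤ n * Real.logb 2 m / k)
    (h : IsLPOptimal (zeroOneMatrix S) b c x) {w : ℕ → ℕ → ℝ} {C X : ℕ → ℝ} {κ : ℝ} (hκ : 0 < κ)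
    (hw : ∀ r j, w r j = 0 ∨ w r j = 1)
    (hwS : ∀ (r : Fin m) (j : Fin n), w r j = if j ∈ S r then 1 else 0)
    (hC0 : ∀ j, 0 ≤ C j) (hC : ∀ j : Fin n, C j = κ * c j) (hX01 : ∀ j, 0 ≤ X j ∧ X j ≤ 1)
    (hX : ∀ j : Fin n, X j = x j) :
    ∃ t < 6 * m + 1, ∀ y : ℕ → ℝ, (∀ i < n, y i = 0 ∨ y i = 1) →
      (∀ r < m, ∑ j ∈ Finset.range n, w r j * y j ≤ (min b (m + n) : ℕ)) →
      ∑ j ∈ Finset.range n, C j * roundReal m n (min b (m + n)) (t + 1 : ℕ) w C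
        (fun j => X j / (t + 1 : ℕ)) n j ≤ ∑ j ∈ Finset.range n, C j * y j →
      IsGoodRounding (1 / 16) (zeroOneMatrix S) b p c x fun i => y i := by
  obtain ⟨t, ht, hpow, hfac⟩ := exists_base (n := n) hm2 hb hp
  refine ⟨t, ht, fun y hy01 hyrow hle => ?_⟩
  have hlog := one_le_logb_two hm2
  have hlam := h.sum_le hk hS hp hc hm (by linarith)
  have hβ : (1 : ℝ) ≤ (t + 1 : ℕ) := by exact_mod_cast Nat.le_add_left 1 t
  have hdot : ∀ v : ℕ → ℝ, ∑ j ∈ Finset.range n, C j * v j = κ * (c ⬝ᵥ fun i => v i) := by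
    intro v
    rw [Finset.sum_range, dotProduct, Finset.mul_sum]
    exact Finset.sum_congr rfl fun j _ => by rw [hC, mul_assoc]
  have hrow : ∀ (v : ℕ → ℝ) (r : Fin m), ∑ j ∈ Finset.range n, w r j * v j = ∑ j ∈ S r, v j := by
    intro v r
    rw [Finset.sum_range]
    simp [hwS]
  have hXx : (fun i : Fin n => X i) = x := funext hX
  have hxrow : ∀ r < m, ∑ j ∈ Finset.range n, w r j * X j ≤ (min b (m + n) : ℕ) := by
    intro r hr
    rw [hrow X ⟨r, hr⟩, Nat.cast_min]
    refine le_min ?_ ?_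
    · have := h.1.2 ⟨r, hr⟩
      rw [zeroOneMatrix_mulVec] at this
      simpa only [hX] using this
    -- Capping the right-hand side is harmless: a row sum of a vector in the unit cube is at most
    -- `n`.
    · calc ∑ j ∈ S ⟨r, hr⟩, X j ≤ ∑ _j ∈ S ⟨r, hr⟩, (1 : ℝ) :=
            Finset.sum_le_sum fun j _ => (hX01 j).2
        _ = ((S ⟨r, hr⟩).card : ℝ) := by simp
        _ ≤ ((m + n : ℕ) : ℝ) := by
            have := Finset.card_le_univ (S ⟨r, hr⟩)
            rw [Fintype.card_fin] at this
            exact_mod_cast this.trans (by omega)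
  have hlamC : ∑ r ∈ Finset.range m, ∑ j ∈ Finset.range n, w r j * (C j * X j) ≤
      min (m : ℝ) (p * Real.logb 2 m) * ∑ j ∈ Finset.range n, C j * X j := by
    rw [hdot, hXx, Finset.sum_range]
    calc ∑ r : Fin m, ∑ j ∈ Finset.range n, w r j * (C j * X j)
        = κ * ∑ r, ∑ i ∈ S r, c i * x i := by
          rw [Finset.mul_sum]
          refine Finset.sum_congr rfl fun r _ => ?_
          rw [hrow (fun j => C j * X j) r, Finset.mul_sum]
          exact Finset.sum_congr rfl fun j _ => by rw [hC, hX, mul_assoc]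
      _ ≤ κ * (min (m : ℝ) (p * Real.logb 2 m) * (c ⬝ᵥ x)) :=
          mul_le_mul_of_nonneg_left hlam hκ.le
      _ = _ := by ring
  have hval := (le_sum_roundReal hβ hw hC0 hX01 hxrow hlamC hpow).trans hle
  rw [hdot, hdot, hXx, mul_div_assoc] at hval
  have hval' := le_of_mul_le_mul_left hval hκ
  have hO0 : 0 ≤ c ⬝ᵥ x := Finset.sum_nonneg fun i _ =>
    mul_nonneg ((by positivity : (0 : ℝ) ≤ 1 / p).trans (hc i).1) (h.1.1 i).1
  refine ⟨fun i => hy01 i i.2, ?_, le_trans ?_ hval'⟩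
  · refine (pi_norm_le_iff_of_nonneg (Nat.cast_nonneg b)).2 fun r => ?_
    rw [zeroOneMatrix_mulVec, Real.norm_of_nonneg (Finset.sum_nonneg fun i _ => by
      rcases hy01 i i.2 with h | h <;> simp [h]), ← hrow y r]
    refine (hyrow r r.2).trans ?_
    exact_mod_cast min_le_left b (m + n)
  · have hf : 0 < approxFactor m b p := by
      have := one_le_approxFactor (b := b) (p := p) hm2
      linarith
    calc 1 / 16 * (c ⬝ᵥ x / approxFactor m b p) = c ⬝ᵥ x / (16 * approxFactor m b p) := by
          field_simp
      _ ≤ c ⬝ᵥ x / (2 * (t + 1 : ℕ)) := div_le_div_of_nonneg_left hO0 (by positivity) hfac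

/-! ### The result of the program on an input -/

theorem Input.matrixOf_load (I : Input m n) (r : Fin m) (j : Fin n) :
    matrixOf n (I.load 1) r j = if j ∈ I.supp r then 1 else 0 := by
  have h : n * (r : ℕ) + j = (finProdFinEquiv (r, j) : Fin (m * n)) := by
    simp [finProdFinEquiv, add_comm]
  unfold matrixOf Input.load
  rw [h]
  simp only [ofFin_apply, Equiv.symm_apply_apply]
  split_ifs <;> simp

theorem Input.matrixOf_load_zero_or_one (I : Input m n) (r j : ℕ) :
    matrixOf n (I.load 1) r j = 0 ∨ matrixOf n (I.load 1) r j = 1 := by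
  have := I.load_matrix_le (n * r + j)
  unfold matrixOf
  interval_cases I.load 1 (n * r + j) <;> simp

theorem rowSum_roundReal_le {β : ℝ} {w : ℕ → ℕ → ℝ} {c u : ℕ → ℝ} (hβ : 1 ≤ β)
    (hw : ∀ r j, w r j = 0 ∨ w r j = 1) (hc : ∀ j, 0 ≤ c j) (hu : ∀ j, 0 ≤ u j ∧ u j ≤ 1) {r : ℕ}
    (hr : r < m) : ∑ j ∈ Finset.range n, w r j * roundReal m n b β w c u n j ≤ b := by
  obtain ⟨s, hs, hsum, -⟩ := exists_rowSum_roundReal (b := b) hβ hw hc hu hr (le_refl n)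
  rw [hsum]
  exact_mod_cast hs

theorem div_succ_mem_Icc {X : ℕ → ℝ} (hX : ∀ j, 0 ≤ X j ∧ X j ≤ 1) (t j : ℕ) :
    0 ≤ X j / (t + 1 : ℕ) ∧ X j / (t + 1 : ℕ) ≤ 1 :=
  ⟨div_nonneg (hX j).1 (by positivity), (div_le_one (by positivity)).2
    ((hX j).2.trans (by exact_mod_cast Nat.le_add_left 1 t))⟩

theorem exists_isGoodRounding {S : Fin m → Finset (Fin n)} {c x : Fin n → ℝ} (hk : 1 ≤ k)
    (hS : ∀ r, (S r).card = k) (hm2 : 2 ≤ m) (hb : 1 ≤ b) (hp : 1 ≤ p)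
    (hc : ∀ i, 1 / p ≤ c i ∧ c i ≤ 1) (hm : (m : ℝ) ≤ n * Real.logb 2 m / k)
    (h : IsLPOptimal (zeroOneMatrix S) b c x) :
    ∃ y, IsGoodRounding (1 / 16) (zeroOneMatrix S) b p c x y := by
  -- Only the stored matrix of this input is used; its rational data are placeholders for the real
  -- `c` and `x`.
  let I : Input m n := ⟨S, b, 0, 0⟩
  let C : ℕ → ℝ := fun j => if h : j < n then c ⟨j, h⟩ else 0
  let X : ℕ → ℝ := fun j => if h : j < n then x ⟨j, h⟩ else 0
  have hC0 : ∀ j, 0 ≤ C j := by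
    intro j
    simp only [C]
    split_ifs with hj
    · exact (by positivity : (0 : ℝ) ≤ 1 / p).trans (hc _).1
    · exact le_rfl
  have hX01 : ∀ j, 0 ≤ X j ∧ X j ≤ 1 := by
    intro j
    simp only [X]
    split_ifs with hj
    · exact h.1.1 _
    · norm_num
  obtain ⟨t, -, ht⟩ := exists_isGoodRounding_of_le hk hS hm2 hb hp hc hm h one_pos
    I.matrixOf_load_zero_or_one I.matrixOf_load hC0 (by simp [C]) hX01 (by simp [X])
  exact ⟨_, ht _ (fun i hi => roundReal_zero_or_one hi) (fun r hr =>
    rowSum_roundReal_le (by exact_mod_cast Nat.le_add_left 1 t) I.matrixOf_load_zero_or_one hC0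
      (div_succ_mem_Icc hX01 t) hr) le_rfl⟩

/-- The integer division in `scaled` is exact, as each denominator divides the product of all. -/
theorem scaled_cast (v d : Fin n → ℕ) (hd : ∀ i, 0 < d i) (i : Fin n) :
    (scaled n (ofFin v) (ofFin d) i : ℝ) =
      (∏ j ∈ Finset.range n, ofFin d j : ℕ) * ((v i : ℝ) / d i) := by
  have hdvd : ofFin d i ∣ ∏ j ∈ Finset.range n, ofFin d j :=
    Finset.dvd_prod_of_mem _ (Finset.mem_range.2 i.2)
  have hne : (ofFin d i : ℝ) ≠ 0 := by
    rw [ofFin_apply]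
    exact_mod_cast (hd i).ne'
  rw [scaled, if_pos i.2, Nat.cast_mul, Nat.cast_div hdvd hne, ofFin_apply, ofFin_apply]
  ring

theorem prod_ofFin_pos (d : Fin n → ℕ) (hd : ∀ i, 0 < d i) :
    0 < ∏ j ∈ Finset.range n, ofFin d j := by
  refine Finset.prod_pos fun j hj => ?_
  have := ofFin_apply (v := d) ⟨j, Finset.mem_range.1 hj⟩
  simp only at this
  rw [this]
  exact hd _

theorem nnrat_num_div_den (q : ℚ≥0) : (q.num : ℝ) / q.den = (q : ℝ) := by
  rw [NNRat.cast_def]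

theorem Input.solDen_pos (I : Input m n) : 0 < I.solDen :=
  prod_ofFin_pos (fun i => (I.x i).den) fun i => (I.x i).den_pos

theorem Input.intSol_cast (I : Input m n) (i : Fin n) :
    (I.intSol i : ℝ) / I.solDen = (I.x i : ℝ) := by
  have hpos : (I.solDen : ℝ) ≠ 0 := by exact_mod_cast I.solDen_pos.ne'
  rw [div_eq_iff hpos, ← nnrat_num_div_den, mul_comm]
  exact scaled_cast (fun i => (I.x i).num) (fun i => (I.x i).den) (fun i => (I.x i).den_pos) i

theorem Input.intSol_div_mem_Icc (I : Input m n) (hx : ∀ i, (I.x i : ℝ) ≤ 1) (j : ℕ) :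
    0 ≤ (I.intSol j : ℝ) / I.solDen ∧ (I.intSol j : ℝ) / I.solDen ≤ 1 := by
  by_cases hj : j < n
  · have := I.intSol_cast ⟨j, hj⟩
    simp only at this
    exact ⟨by positivity, this ▸ hx _⟩
  · simp [Input.intSol, scaled, hj]

/-- After rounding, each coordinate below `n` is `0` or `N`, so dividing by `N` in natural numbers
loses nothing. -/
theorem Input.candidate_cast (I : Input m n) (t : ℕ) {i : ℕ} (hi : i < n) :
    (I.candidate t i : ℝ) = roundReal m n (min I.b (m + n)) (t + 1 : ℕ)
      (matrixOf n (I.load 1)) (fun j => (I.intWeights j : ℝ))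
      (fun j => (I.intSol j : ℝ) / I.solDen / (t + 1 : ℕ)) n i := by
  have hN : 0 < (t + 1) * I.solDen := Nat.mul_pos (Nat.succ_pos t) I.solDen_pos
  have hN' : (((t + 1) * I.solDen : ℕ) : ℝ) ≠ 0 := by exact_mod_cast hN.ne'
  have hcast := congrFun (roundNat_cast (m := m) (n := n) (b := min I.b (m + n)) (A := I.load 1)
    (C := I.intWeights) hN (Nat.le_add_left 1 t) I.intSol n) i
  have hX : (fun l => (I.intSol l : ℝ) / ((t + 1) * I.solDen : ℕ)) =
      fun j => (I.intSol j : ℝ) / I.solDen / (t + 1 : ℕ) := by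
    funext l
    rw [div_div, Nat.cast_mul, mul_comm]
  rw [hX] at hcast
  rw [← hcast]
  unfold Input.candidate roundedVec
  have h01 := roundReal_zero_or_one (m := m) (n := n) (b := min I.b (m + n))
    (β := (t + 1 : ℕ)) (w := matrixOf n (I.load 1)) (c := fun j => (I.intWeights j : ℝ))
    (u := fun j => (I.intSol j : ℝ) / I.solDen / (t + 1 : ℕ)) hi
  rw [← hcast] at h01
  refine Nat.cast_div ?_ hN'
  rcases h01 with h0 | h1
  · have : roundNat m n ((t + 1) * I.solDen) (t + 1)
        (((t + 1) * I.solDen) ^ n * (t + 1) ^ min I.b (m + n)) (I.load 1) I.intWeights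
        I.intSol n i = 0 := by
      exact_mod_cast (div_eq_zero_iff.1 h0).resolve_right hN'
    rw [this]
    exact dvd_zero _
  · have : roundNat m n ((t + 1) * I.solDen) (t + 1)
        (((t + 1) * I.solDen) ^ n * (t + 1) ^ min I.b (m + n)) (I.load 1) I.intWeights
        I.intSol n i = (t + 1) * I.solDen := by
      exact_mod_cast (div_eq_one_iff_eq hN').1 h1
    rw [this]

/-- The output is the zero vector or a candidate, hence feasible. It is at least as good as the
candidate for the suitable `β`, which the program need not know. The scale `κ` is the common
denominator of the weights. -/
theorem Input.isGoodRounding (I : Input m n) (hk : 1 ≤ k) (hS : ∀ r, (I.supp r).card = k)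
    (hm2 : 2 ≤ m) (hb : 1 ≤ I.b) (hp : 1 ≤ p)
    (hc : ∀ i, 1 / p ≤ (I.c i : ℝ) ∧ (I.c i : ℝ) ≤ 1) (hm : (m : ℝ) ≤ n * Real.logb 2 m / k)
    (h : IsLPOptimal (zeroOneMatrix I.supp) I.b (fun i => (I.c i : ℝ)) fun i => (I.x i : ℝ))
    {z : ℕ → ℕ} (hz : BestRounding n I.intWeights I.candidate (6 * m + 1) z) :
    IsGoodRounding (1 / 16) (zeroOneMatrix I.supp) I.b p (fun i => (I.c i : ℝ))
      (fun i => (I.x i : ℝ)) fun i => (z i : ℝ) := by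
  have hX01 := I.intSol_div_mem_Icc fun i => (h.1.1 i).2
  have hκ : (0 : ℝ) < (∏ j ∈ Finset.range n, I.load 3 j : ℕ) := by
    exact_mod_cast prod_ofFin_pos (fun i => (I.c i).den) fun i => (I.c i).den_pos
  obtain ⟨t, ht, hgood⟩ := exists_isGoodRounding_of_le hk hS hm2 hb hp hc hm h
    (C := fun j => (I.intWeights j : ℝ)) (X := fun j => (I.intSol j : ℝ) / I.solDen) hκ
    I.matrixOf_load_zero_or_one I.matrixOf_load (fun j => Nat.cast_nonneg _) (fun j => by
      rw [← nnrat_num_div_den]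
      exact scaled_cast (fun i => (I.c i).num) (fun i => (I.c i).den)
        (fun i => (I.c i).den_pos) j) hX01 I.intSol_cast
  refine hgood (fun i => (z i : ℝ)) ?_ ?_ ?_
  · intro i hi
    rcases hz.eq with h0 | ⟨t', -, ht'⟩
    · simp [h0 i hi]
    · simp only [ht' i hi, I.candidate_cast t' hi]
      exact roundReal_zero_or_one hi
  · intro r hr
    rcases hz.eq with h0 | ⟨t', -, ht'⟩
    · rw [Finset.sum_eq_zero fun j hj => by simp [h0 j (Finset.mem_range.1 hj)]]
      exact Nat.cast_nonneg _
    · rw [Finset.sum_congr rfl fun j hj => by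
        rw [ht' j (Finset.mem_range.1 hj), I.candidate_cast t' (Finset.mem_range.1 hj)]]
      exact rowSum_roundReal_le (by exact_mod_cast Nat.le_add_left 1 t')
        I.matrixOf_load_zero_or_one (fun j => Nat.cast_nonneg _) (div_succ_mem_Icc hX01 t') hr
  · have hle := hz.le t ht
    rw [← Nat.cast_le (α := ℝ)] at hle
    push_cast at hle
    rw [Finset.sum_congr rfl fun j hj => by
      rw [I.candidate_cast t (Finset.mem_range.1 hj)]] at hle
    exact_mod_cast hle

theorem uniformProb_of_forall {Ω : Type} [Fintype Ω] [Nonempty Ω] {E : Ω → Prop}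
    (h : ∀ x, E x) : uniformProb E = 1 := by
  have : (Fintype.card Ω : ℝ) ≠ 0 := by exact_mod_cast Fintype.card_ne_zero
  simp [uniformProb, h, this]

end Final

end PackingRounding

/-! ### The theorem -/

open PackingRounding in
theorem mainTheorem2 :
    ∃ γ : ℝ, 0 < γ ∧ ∀ a : ℕ, ∃ (P : Prog) (q : Polynomial ℕ), RunsInTime P q ∧
      ∀ m n k b : ℕ, 1 ≤ m → 1 ≤ k → k ≤ n → 1 ≤ b →
        (m : ℝ) ≤ n * Real.logb 2 m / k →
        1 - 1 / (m : ℝ) ^ a ≤ uniformProb fun R : RowChoice m n k =>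
          -- every optimal solution, with arbitrary real data, has a good rounding
          (∀ (p : ℝ) (c x : Fin n → ℝ), 1 ≤ p → (∀ i, 1 / p ≤ c i ∧ c i ≤ 1) →
            IsLPOptimal (zeroOneMatrix R.supports) b c x →
            ∃ y, IsGoodRounding γ (zeroOneMatrix R.supports) b p c x y) ∧
          -- for rational data, the program finds one in polynomial time with high probability
          (∀ (p : ℝ) (c x : Fin n → ℚ≥0), 1 ≤ p → (∀ i, 1 / p ≤ (c i : ℝ) ∧ (c i : ℝ) ≤ 1) →
            IsLPOptimal (zeroOneMatrix R.supports) b (fun i => (c i : ℝ)) (fun i => (x i : ℝ)) →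
            1 - 1 / (m : ℝ) ^ a ≤ uniformProb fun
              r : Fin (q.eval (Input.length ⟨R.supports, b, c, x⟩)) → Bool =>
                RunsTo P ⟨R.supports, b, c, x⟩ (q.eval (Input.length ⟨R.supports, b, c, x⟩))
                  (coins r)
                  (IsGoodRounding γ (zeroOneMatrix R.supports) b p
                    (fun i => (c i : ℝ)) (fun i => (x i : ℝ)))) := by
  refine ⟨1 / 16, by norm_num, fun a => ⟨mainProg, timeBound, fun m n I ω => ?_, ?_⟩⟩
  · obtain ⟨z, -, hrun⟩ := I.exists_run_mainProg
    obtain ⟨s, t, hexec, ht, -⟩ := hrun ω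
    exact ⟨s, t, hexec, ht, trivial⟩
  intro m n k b hm1 hk hkn hb hm
  -- For `m = 1` the hypothesis `hm` would read `1 ≤ 0`.
  have hm2 : 2 ≤ m := by
    by_contra hlt
    obtain rfl : m = 1 := by omega
    norm_num at hm
  have hone : 1 - 1 / (m : ℝ) ^ a ≤ 1 := sub_le_self _ (by positivity)
  -- On an empty sample space `uniformProb` would be `0 / 0 = 0`; `k ≤ n` excludes this.
  have hne : Nonempty (RowChoice m n k) := by
    obtain ⟨s, -, hs⟩ := Finset.exists_subset_card_eq
      (s := (Finset.univ : Finset (Fin n))) (n := k) (by simpa using hkn)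
    exact ⟨fun _ => ⟨s, hs⟩⟩
  refine hone.trans (uniformProb_of_forall fun R => ⟨?_, ?_⟩).ge
  · intro p c x hp hc h
    exact exists_isGoodRounding hk (fun r => (R r).2) hm2 hb hp hc hm h
  · intro p c x hp hc h
    refine hone.trans (uniformProb_of_forall fun r => ?_).ge
    obtain ⟨z, hz, hrun⟩ := (⟨R.supports, b, c, x⟩ : Input m n).exists_run_mainProg
    obtain ⟨s, t, hexec, ht, hout⟩ := hrun (coins r)
    refine ⟨s, t, hexec, ht, ?_⟩
    rw [hout]
    exact Input.isGoodRounding ⟨R.supports, b, c, x⟩ hk (fun r => (R r).2) hm2 hb hp hc hm h hz
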